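/- Let $\ell\ge 0$ be an integer and $\alpha=(\alpha_1,\ldots,\alpha_\ell)\in\mathbb{C}^\ell$. For every $t>0$ the multiple series $$Z^{[\ell]}_{\alpha}(t):=\sum_{\delta_1,\ldots,\delta_\ell=1}^{\infty}\delta_1^{\alpha_1-1}\cdots\delta_\ell^{\alpha_\ell-1}\,e^{-\delta_1\cdots\delta_\ell t}$$ converges absolutely (for $\ell=0$ it is understood as $e^{-t}$). As $t\to0^+$ it has the full asymptotic expansion $$Z^{[\ell]}_{\alpha}(t)\sim\sum_{(a,b)}\mathscr{C}^{[\ell]}_{a,b}(\alpha)\,t^a(-\ln t)^b,$$ where the sum is over all pairs $(a,b)$ with $a$ in the set $\mathbb{N}\cup\{-\alpha_1,\ldots,-\alpha_\ell\}\subset\mathbb{C}$ (with $\mathbb{N}=\{0,1,2,\ldots\}$, each element of the set being counted once) and $b\in\{0,1,\ldots,\ell\}$. The meaning of the expansion is that for every real $N\ge0$, $$Z^{[\ell]}_{\alpha}(t)-\sum_{(a,b):\,\operatorname{Re}a\le N}\mathscr{C}^{[\ell]}_{a,b}(\alpha)\,t^a(-\ln t)^b=o(t^N)\qquad(t\to0^+).$$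 The coefficients are $$\mathscr{C}^{[\ell]}_{a,b}(\alpha):=\frac{1}{b!}\sum_{\substack{p,k_1,\ldots,k_\ell\ge0\\ b+p+k_1+\cdots+k_\ell=\ell}}\Big([z^p]\,z\Gamma(-a+z)\Big)\prod_{j=1}^{\ell}\Big([z^{k_j}]\,z\zeta(-a+1-\alpha_j+z)\Big),$$ where $\Gamma$ is the Euler gamma function, $\zeta$ is the Riemann zeta function, and $[z^k]f(z)$ denotes the coefficient of $z^k$ in the power series expansion at $z=0$ of $f$, a possible removable singularity of $f$ at $0$ being removed. -/

import Mathlib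

open Filter Topology Asymptotics

/-- The general term of the multiple sum, for positive integers `δ 0, …, δ (ℓ - 1)`. -/
noncomputable def ZTerm {ℓ : ℕ} (α : Fin ℓ → ℂ) (t : ℝ) (δ : Fin ℓ → ℕ+) : ℂ :=
  (∏ j, ((δ j : ℕ) : ℂ) ^ (α j - 1)) * Complex.exp (-((∏ j, ((δ j : ℕ) : ℂ)) * (t : ℂ)))

/-- The multiple sum `Z_α^{[ℓ]}(t)`, over all `ℓ`-tuples of positive integers. -/
noncomputable def ZSum {ℓ : ℕ} (α : Fin ℓ → ℂ) (t : ℝ) : ℂ :=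
  ∑' δ : Fin ℓ → ℕ+, ZTerm α t δ

/-- The function `f` with its value at `0` replaced by its limit there (so that a removable
singularity at `0` is removed). -/
noncomputable def regularize (f : ℂ → ℂ) : ℂ → ℂ :=
  Function.update f 0 (limUnder (𝓝[≠] 0) f)

/-- `[z^k] f(z)`: the `k`-th Taylor coefficient at `0` of `f`, after removal of a removable
singularity at `0`. -/
noncomputable def taylorCoeff (f : ℂ → ℂ) (k : ℕ) : ℂ :=
  iteratedDeriv k (regularize f) 0 / (k.factorial : ℂ)

/-- The coefficient `C_{a,b}^{[ℓ]}(α)`. The constraint bounds every summation index by `ℓ`, so the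
sum over all indices `p, k_1, …, k_ℓ ≥ 0` is written as a sum over indices at most `ℓ`. -/
noncomputable def expansionCoeff {ℓ : ℕ} (α : Fin ℓ → ℂ) (a : ℂ) (b : ℕ) : ℂ :=
  1 / (b.factorial : ℂ) *
    ∑ p ∈ Finset.range (ℓ + 1),
      ∑ k ∈ Fintype.piFinset (fun _ : Fin ℓ => Finset.range (ℓ + 1)),
        if b + p + ∑ j, k j = ℓ then
          taylorCoeff (fun z => z * Complex.Gamma (-a + z)) p *
            ∏ j, taylorCoeff (fun z => z * riemannZeta (-a + 1 - α j + z)) (k j)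
        else 0

/-- The set `ℕ ∪ {-α_1, …, -α_ℓ}` of exponents. -/
def exponents {ℓ : ℕ} (α : Fin ℓ → ℂ) : Set ℂ :=
  Set.range (fun n : ℕ => (n : ℂ)) ∪ Set.range (fun j => -α j)

theorem exponents_finite {ℓ : ℕ} (α : Fin ℓ → ℂ) (N : ℝ) :
    {a ∈ exponents α | a.re ≤ N}.Finite := by
  refine (((Set.finite_Iic ⌊N⌋₊).image (fun n : ℕ => (n : ℂ))).union
    (Set.finite_range (fun j => -α j))).subset ?_
  rintro a ⟨⟨n, rfl⟩ | h, hN⟩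
  · left
    exact ⟨n, Nat.le_floor (by simpa using hN), rfl⟩
  · exact Or.inr h

/-- The part of the expansion with `Re a ≤ N`. -/
noncomputable def partialExpansion {ℓ : ℕ} (α : Fin ℓ → ℂ) (N : ℝ) (t : ℝ) : ℂ :=
  ∑ a ∈ (exponents_finite α N).toFinset, ∑ b ∈ Finset.range (ℓ + 1),
    expansionCoeff α a b * (t : ℂ) ^ a * ((-Real.log t : ℝ) : ℂ) ^ b

theorem analyticAt_regularize {f : ℂ → ℂ} {c : ℂ} (hc : Tendsto f (𝓝[≠] 0) (𝓝 c))
    (hd : ∀ᶠ z in 𝓝[≠] (0 : ℂ), DifferentiableAt ℂ f z) :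
    AnalyticAt ℂ (regularize f) 0 := by
  unfold regularize
  rw [hc.limUnder_eq]
  refine Complex.analyticAt_of_differentiable_on_punctured_nhds_of_continuousAt ?_
    (continuousAt_update_same.2 hc)
  filter_upwards [hd, self_mem_nhdsWithin] with z hz hz0
  refine hz.congr_of_eventuallyEq ?_
  filter_upwards [isOpen_ne.mem_nhds hz0] with w hw
  exact Function.update_of_ne hw _ _

/-- The functions `z ζ(u + z)` do have a power series expansion at `0`. -/
theorem analyticAt_regularize_zeta (u : ℂ) :
    AnalyticAt ℂ (regularize fun z => z * riemannZeta (u + z)) 0 := by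
  by_cases hu : u = 1
  · subst hu
    refine analyticAt_regularize (c := 1) ?_ ?_
    · have h : Tendsto (fun z : ℂ => 1 + z) (𝓝[≠] 0) (𝓝[≠] 1) := by
        refine tendsto_nhdsWithin_iff.2 ⟨?_, ?_⟩
        · have : Continuous fun z : ℂ => 1 + z := by fun_prop
          simpa using (this.tendsto 0).mono_left nhdsWithin_le_nhds
        · filter_upwards [self_mem_nhdsWithin] with z hz
          simpa using hz
      simpa [Function.comp_def] using riemannZeta_residue_one.comp h
    · filter_upwards [self_mem_nhdsWithin] with z hz
      have h1 : DifferentiableAt ℂ riemannZeta (1 + z) :=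
        differentiableAt_riemannZeta (by simpa using hz)
      have h2 : DifferentiableAt ℂ (fun z : ℂ => 1 + z) z := by fun_prop
      exact differentiableAt_id.mul (h1.comp z h2)
  · have hd : ∀ᶠ z in 𝓝 (0 : ℂ), DifferentiableAt ℂ (fun z => z * riemannZeta (u + z)) z := by
      have : Continuous fun z : ℂ => u + z := by fun_prop
      have h : ∀ᶠ z in 𝓝 (0 : ℂ), u + z ≠ 1 :=
        this.continuousAt.eventually_ne (by simpa using hu)
      filter_upwards [h] with z hz
      have h2 : DifferentiableAt ℂ (fun z : ℂ => u + z) z := by fun_prop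
      exact differentiableAt_id.mul ((differentiableAt_riemannZeta hz).comp z h2)
    exact analyticAt_regularize (hd.self_of_nhds.continuousAt.tendsto.mono_left
      nhdsWithin_le_nhds) (hd.filter_mono nhdsWithin_le_nhds)

/-- The functions `z Γ(u + z)` do have a power series expansion at `0`. -/
theorem analyticAt_regularize_Gamma (u : ℂ) :
    AnalyticAt ℂ (regularize fun z => z * Complex.Gamma (u + z)) 0 := by
  have key : ∀ (n : ℕ) (u : ℂ), 0 < (u + n).re →
      ∃ g : ℂ → ℂ, (fun z => z * Complex.Gamma (u + z)) =ᶠ[𝓝[≠] 0] g ∧ AnalyticAt ℂ g 0 := by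
    intro n
    induction n with
    | zero =>
      intro u hu
      refine ⟨_, EventuallyEq.rfl, ?_⟩
      rw [Complex.analyticAt_iff_eventually_differentiableAt]
      have hcont : Continuous fun z : ℂ => (u + z).re := by fun_prop
      have h : ∀ᶠ z in 𝓝 (0 : ℂ), 0 < (u + z).re :=
        hcont.continuousAt.eventually (lt_mem_nhds (by simpa using hu))
      filter_upwards [h] with z hz
      have h2 : DifferentiableAt ℂ (fun z : ℂ => u + z) z := by fun_prop
      refine differentiableAt_id.mul ((Complex.differentiableAt_Gamma _ fun m hm => ?_).comp z h2)
      rw [hm] at hz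
      have : (0 : ℝ) ≤ m := m.cast_nonneg
      simp at hz
      linarith
    | succ n ih =>
      intro u hu
      by_cases h0 : u = 0
      · subst h0
        refine ⟨fun z => Complex.Gamma (z + 1), ?_, ?_⟩
        · filter_upwards [self_mem_nhdsWithin] with z hz
          rw [zero_add, Complex.Gamma_add_one z hz]
        · rw [Complex.analyticAt_iff_eventually_differentiableAt]
          have hcont : Continuous fun z : ℂ => (z + 1).re := by fun_prop
          have h : ∀ᶠ z in 𝓝 (0 : ℂ), 0 < (z + 1).re :=
            hcont.continuousAt.eventually (lt_mem_nhds (by simp))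
          filter_upwards [h] with z hz
          have h2 : DifferentiableAt ℂ (fun z : ℂ => z + 1) z := by fun_prop
          refine (Complex.differentiableAt_Gamma _ fun m hm => ?_).comp z h2
          rw [hm] at hz
          have : (0 : ℝ) ≤ m := m.cast_nonneg
          simp at hz
          linarith
      · obtain ⟨g, hg, hga⟩ := ih (u + 1) (by simp at hu ⊢; linarith)
        refine ⟨fun z => g z / (u + z), ?_, ?_⟩
        · have hcont : Continuous fun z : ℂ => u + z := by fun_prop
          have h : ∀ᶠ z in 𝓝 (0 : ℂ), u + z ≠ 0 :=
            hcont.continuousAt.eventually_ne (by simpa using h0)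
          filter_upwards [hg, h.filter_mono nhdsWithin_le_nhds] with z hz hz0
          rw [← hz, show u + 1 + z = u + z + 1 by ring, Complex.Gamma_add_one _ hz0]
          field_simp
        · exact hga.div (by fun_prop) (by simpa using h0)
  obtain ⟨n, hn⟩ := exists_nat_gt (-u.re)
  obtain ⟨g, hg, hga⟩ := key n u (by simp; linarith)
  refine analyticAt_regularize
    ((hga.continuousAt.tendsto.mono_left nhdsWithin_le_nhds).congr' hg.symm) ?_
  have h1 : ∀ᶠ z in 𝓝[≠] (0 : ℂ), DifferentiableAt ℂ g z :=
    ((Complex.analyticAt_iff_eventually_differentiableAt).1 hga).filter_mono nhdsWithin_le_nhds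
  filter_upwards [h1, eventually_eventually_nhdsWithin.2 hg, self_mem_nhdsWithin] with z hz hz1 hz0
  rw [isOpen_compl_singleton.nhdsWithin_eq hz0] at hz1
  exact hz.congr_of_eventuallyEq hz1

/-! ### Exponential decay of Γ in vertical strips. -/

section GammaDecay

open Complex MeasureTheory Set

/-! The proof is Mellin inversion followed by a contour shift. Inserting `e^{-x} = (1/2πi) ∫ Γ(s)
x^{-s} ds` on a line `Re s = c`, with `c` positive and larger than every `Re α_j`, and summing over
the `δ_j` gives `Z(t) = (1/2πi) ∫ t^{-s} Γ(s) ∏ ζ(s + 1 - α_j) ds` (`hasSum_ZTerm`).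

The poles of the integrand lie in the set of `s = -a` with `a` an exponent. Writing `s = -a + z`,
one has `t^{-s} = t^a exp(z (-ln t))`, while `z^{ℓ+1}` times the Mellin transform is the product of
the regularized factors `z Γ` and `z ζ`. The residue is therefore `t^a` times the coefficient of
`z^ℓ` in a product of power series; the exponential series supplies `(-ln t)^b / b!`, and the
remaining coefficient of `z^{ℓ-b}` supplies the inner sum in the formula (`principalCoeff_zero`).

Choose `M > N` so that no exponent has real part in `(N, M]`. Moving the line to `Re s = -M`
collects exactly the terms with `Re a ≤ N`, and the integral that remains is `O(t^M)`, hence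
`o(t^N)` (`ZSum_sub_partialExpansion`).

The shift needs the integrand to vanish at the ends of the strip. Rotating Euler's integral shows
that Γ decays like `exp(-θ |Im s|)` for every `θ < π/2` (`stripExpBound_Gamma`), while ζ grows more
slowly than any `exp(ε |Im s|)` (`stripExpBound_riemannZeta`). The residue theorem for a strip,
`tendsto_integral_sub_residues`, subtracts principal parts, whose integrals are explicit, and
applies Cauchy's theorem to the rest. -/

theorem integrableOn_rpow_mul_exp_neg_mul {σ b : ℝ} (hσ : -1 < σ) (hb : 0 < b) :
    IntegrableOn (fun t : ℝ => t ^ σ * Real.exp (-b * t)) (Ioi 0) := by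
  simpa using integrableOn_rpow_mul_exp_neg_mul_rpow hσ one_pos hb

theorem norm_cpow_mul_exp_neg_mul {a r : ℂ} {t : ℝ} (ht : 0 < t) :
    ‖(t : ℂ) ^ a * exp (-(r * t))‖ = t ^ a.re * Real.exp (-r.re * t) := by
  rw [norm_mul, norm_cpow_eq_rpow_re_of_pos ht, norm_exp]
  simp

theorem aestronglyMeasurable_cpow_mul_exp_neg_mul (a r : ℂ) :
    AEStronglyMeasurable (fun t : ℝ => (t : ℂ) ^ a * exp (-(r * t)))
      (volume.restrict (Ioi 0)) := by
  refine ContinuousOn.aestronglyMeasurable (fun t ht => ?_) measurableSet_Ioi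
  refine ContinuousAt.continuousWithinAt (ContinuousAt.mul ?_ (by fun_prop))
  exact (continuousAt_ofReal_cpow_const _ _ (Or.inr (ne_of_gt ht)))

theorem integrableOn_cpow_mul_exp_neg_mul {a r : ℂ} (ha : -1 < a.re) (hr : 0 < r.re) :
    IntegrableOn (fun t : ℝ => (t : ℂ) ^ a * exp (-(r * t))) (Ioi 0) := by
  refine (integrableOn_rpow_mul_exp_neg_mul ha hr).mono'
    (aestronglyMeasurable_cpow_mul_exp_neg_mul a r) ?_
  filter_upwards [ae_restrict_mem measurableSet_Ioi] with t ht
  exact (norm_cpow_mul_exp_neg_mul ht).le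

theorem differentiableAt_integral_cpow_mul_exp_neg_mul {a r : ℂ} (ha : 0 < a.re) (hr : 0 < r.re) :
    DifferentiableAt ℂ (fun r : ℂ => ∫ t : ℝ in Ioi 0, (t : ℂ) ^ (a - 1) * exp (-(r * t))) r := by
  have hopen : {w : ℂ | r.re / 2 < w.re} ∈ 𝓝 r :=
    (isOpen_lt continuous_const continuous_re).mem_nhds (by simpa using hr)
  refine (hasDerivAt_integral_of_dominated_loc_of_deriv_le (μ := volume.restrict (Ioi 0))
    (F := fun (r : ℂ) (t : ℝ) => (t : ℂ) ^ (a - 1) * exp (-(r * t)))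
    (F' := fun (r : ℂ) (t : ℝ) => (t : ℂ) ^ (a - 1) * (exp (-(r * t)) * (-t)))
    (bound := fun t : ℝ => t ^ a.re * Real.exp (-(r.re / 2) * t))
    hopen (Eventually.of_forall fun r => aestronglyMeasurable_cpow_mul_exp_neg_mul _ _)
    (integrableOn_cpow_mul_exp_neg_mul (by simpa using ha) hr) ?_ ?_ ?_ ?_).2.differentiableAt
  · have := (aestronglyMeasurable_cpow_mul_exp_neg_mul (a - 1) r).mul
      (continuous_ofReal.neg.aestronglyMeasurable (μ := volume.restrict (Ioi (0 : ℝ))))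
    refine this.congr (Eventually.of_forall fun t => ?_)
    simp [mul_assoc]
  · filter_upwards [ae_restrict_mem measurableSet_Ioi] with t ht w hw
    have ht' : 0 < t := ht
    rw [← mul_assoc, norm_mul, norm_cpow_mul_exp_neg_mul ht, norm_neg, norm_real,
      Real.norm_of_nonneg ht'.le, sub_re, one_re, Real.rpow_sub_one ht'.ne']
    have : Real.exp (-w.re * t) ≤ Real.exp (-(r.re / 2) * t) := by
      gcongr
    calc t ^ a.re / t * Real.exp (-w.re * t) * t = t ^ a.re * Real.exp (-w.re * t) := by
          field_simp
      _ ≤ _ := by gcongr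
  · exact integrableOn_rpow_mul_exp_neg_mul (by linarith) (by positivity)
  · refine Eventually.of_forall fun t w _ => HasDerivAt.const_mul _ (HasDerivAt.cexp ?_)
    simpa only [one_mul, id] using! ((hasDerivAt_id w).mul_const (t : ℂ)).neg

/-- Euler's integral along a rotated ray. -/
theorem cpow_mul_integral_cpow_mul_exp_neg_mul {a r : ℂ} (ha : 0 < a.re) (hr : 0 < r.re) :
    r ^ a * ∫ t : ℝ in Ioi 0, (t : ℂ) ^ (a - 1) * exp (-(r * t)) = Gamma a := by
  have hopen : IsOpen {w : ℂ | 0 < w.re} := isOpen_lt continuous_const continuous_re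
  have hd : DifferentiableOn ℂ
      (fun r : ℂ => r ^ a * ∫ t : ℝ in Ioi 0, (t : ℂ) ^ (a - 1) * exp (-(r * t)))
      {w : ℂ | 0 < w.re} := by
    intro w hw
    refine DifferentiableAt.differentiableWithinAt (DifferentiableAt.mul ?_
      (differentiableAt_integral_cpow_mul_exp_neg_mul ha hw))
    exact differentiableAt_id.cpow_const (Or.inl hw)
  have hconst : DifferentiableOn ℂ (fun _ : ℂ => Gamma a) {w : ℂ | 0 < w.re} :=
    differentiableOn_const _
  -- Identity theorem on the right half-plane: for real `r > 0` the formula is a substitution in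
  -- Euler's integral, and the real points to the right of 1 accumulate at 1.
  refine (hd.analyticOnNhd hopen).eqOn_of_preconnected_of_frequently_eq
    (hconst.analyticOnNhd hopen) (convex_halfSpace_re_gt 0).isPreconnected (z₀ := 1)
    (by simp) ?_ hr
  have hfreq : ∃ᶠ x : ℝ in 𝓝[>] 1, (fun r : ℂ => r ^ a * ∫ t : ℝ in Ioi 0,
      (t : ℂ) ^ (a - 1) * exp (-(r * t))) x = Gamma a := by
    refine Eventually.frequently ?_
    filter_upwards [self_mem_nhdsWithin] with x hx
    have hx0 : (0 : ℝ) < x := zero_lt_one.trans hx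
    have hxc : (x : ℂ) ≠ 0 := by exact_mod_cast hx0.ne'
    rw [integral_cpow_mul_exp_neg_mul_Ioi ha hx0, ← mul_assoc, one_div, inv_cpow _ _ ?_,
      mul_inv_cancel₀, one_mul]
    · simp [cpow_eq_zero_iff, hxc]
    · rw [arg_ofReal_of_nonneg hx0.le]
      exact Real.pi_pos.ne
  have ht : Tendsto (fun x : ℝ => (x : ℂ)) (𝓝[>] 1) (𝓝[≠] 1) := by
    refine tendsto_nhdsWithin_iff.2 ⟨?_, ?_⟩
    · simpa using (continuous_ofReal.tendsto 1).mono_left nhdsWithin_le_nhds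
    · filter_upwards [self_mem_nhdsWithin] with x hx
      have : x ≠ 1 := ne_of_gt hx
      simpa using this
  exact ht.frequently hfreq

/-- Take `r = e^{iθ}` in the rotated integral. The factor `r^s` has modulus `e^{-θ Im s}`, and the
absolute integral only sees the decay rate `Re r = cos θ`. -/
theorem norm_Gamma_le_exp_neg {s : ℂ} (hs : 0 < s.re) {θ : ℝ} (hθ : |θ| < Real.pi / 2) :
    ‖Gamma s‖ ≤ Real.exp (-(θ * s.im)) * ((1 / Real.cos θ) ^ s.re * Real.Gamma s.re) := by
  have hcos : 0 < Real.cos θ := Real.cos_pos_of_mem_Ioo (abs_lt.1 hθ |> fun h => ⟨h.1, h.2⟩)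
  have hre : (exp (θ * I)).re = Real.cos θ := exp_ofReal_mul_I_re θ
  have hpow : ‖exp (θ * I) ^ s‖ = Real.exp (-(θ * s.im)) := by
    rw [norm_cpow_of_ne_zero (exp_ne_zero _), norm_exp_ofReal_mul_I, Real.one_rpow, one_div,
      Real.exp_neg, arg_exp_mul_I, toIocMod_eq_self Real.two_pi_pos |>.2]
    have := abs_lt.1 hθ
    have := Real.pi_pos
    constructor <;> linarith
  rw [← cpow_mul_integral_cpow_mul_exp_neg_mul hs (hre ▸ hcos), norm_mul, hpow]
  gcongr
  refine (norm_integral_le_integral_norm _).trans (le_of_eq ?_)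
  rw [← Real.integral_rpow_mul_exp_neg_mul_Ioi hs hcos]
  refine setIntegral_congr_fun measurableSet_Ioi fun t ht => ?_
  rw [norm_cpow_mul_exp_neg_mul ht, hre]
  simp

/-- `f` grows at most like `exp (r |Im s|)` in the vertical strip `A ≤ Re s ≤ B`. -/
def StripExpBound (f : ℂ → ℂ) (A B r : ℝ) : Prop :=
  ∃ C T : ℝ, ∀ s : ℂ, A ≤ s.re → s.re ≤ B → T ≤ |s.im| → ‖f s‖ ≤ C * Real.exp (r * |s.im|)

namespace StripExpBound

variable {f g : ℂ → ℂ} {A B r r' : ℝ}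

theorem mono_right (h : StripExpBound f A B r) (hr : r ≤ r') : StripExpBound f A B r' := by
  obtain ⟨C, T, h⟩ := h
  refine ⟨|C|, T, fun s hA hB hT => (h s hA hB hT).trans ?_⟩
  gcongr
  exact le_abs_self C

theorem mul (hf : StripExpBound f A B r) (hg : StripExpBound g A B r') :
    StripExpBound (fun s => f s * g s) A B (r + r') := by
  obtain ⟨C, T, hf⟩ := hf
  obtain ⟨C', T', hg⟩ := hg
  refine ⟨C * C', max T T', fun s hA hB hT => ?_⟩
  have h1 := hf s hA hB ((le_max_left _ _).trans hT)
  have h2 := hg s hA hB ((le_max_right _ _).trans hT)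
  rw [norm_mul, add_mul, Real.exp_add]
  calc ‖f s‖ * ‖g s‖ ≤ (C * Real.exp (r * |s.im|)) * (C' * Real.exp (r' * |s.im|)) :=
        mul_le_mul h1 h2 (norm_nonneg _) ((norm_nonneg _).trans h1)
    _ = _ := by ring

/-- A translation changes `|Im s|` by at most `|Im c|`, which is absorbed into the constant. -/
theorem comp_add_const (c : ℂ) (hr : 0 ≤ r) (hf : StripExpBound f (A + c.re) (B + c.re) r) :
    StripExpBound (fun s => f (s + c)) A B r := by
  obtain ⟨C, T, hf⟩ := hf
  refine ⟨|C| * Real.exp (r * |c.im|), T + |c.im|, fun s hA hB hT => ?_⟩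
  have h1 : |s.im| ≤ |(s + c).im| + |c.im| := by
    simpa using abs_sub (s + c).im c.im
  have h2 : |(s + c).im| ≤ |c.im| + |s.im| := by
    simpa [add_comm] using abs_add_le c.im s.im
  have h3 := hf (s + c) (by simpa using hA) (by simpa using hB) (by linarith)
  refine h3.trans ?_
  rw [mul_assoc, ← Real.exp_add, ← mul_add]
  gcongr
  exact le_abs_self C

theorem prod {ι : Type*} (S : Finset ι) {f : ι → ℂ → ℂ}
    (h : ∀ i ∈ S, ∀ ε > 0, StripExpBound (f i) A B ε) {ε : ℝ} (hε : 0 < ε) :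
    StripExpBound (fun s => ∏ i ∈ S, f i s) A B ε := by
  classical
  induction S using Finset.induction_on generalizing ε with
  | empty =>
    refine ⟨1, 0, fun s _ _ _ => ?_⟩
    simp
    positivity
  | insert i S hi ih =>
    simp only [Finset.prod_insert hi]
    have h1 := h i (Finset.mem_insert_self _ _) (ε / 2) (by positivity)
    have h2 := ih (fun j hj => h j (Finset.mem_insert_of_mem hj)) (half_pos hε)
    simpa using h1.mul h2

end StripExpBound

/-- When the strip lies in `Re s > 0`, use `norm_Gamma_le_exp_neg` with the angle `±θ` having the
sign of `Im s`. Strips further left follow from `Γ(s + 1) = s Γ(s)`, since dividing by `s` with `|s|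
≥ 1` only helps. -/
theorem stripExpBound_Gamma (A B : ℝ) {θ : ℝ} (h0 : 0 ≤ θ) (hθ : θ < Real.pi / 2) :
    StripExpBound Gamma A B (-θ) := by
  have key : ∀ (n : ℕ) (A B : ℝ), 0 < A + n → ∃ C : ℝ, ∀ s : ℂ, A ≤ s.re → s.re ≤ B →
      1 ≤ |s.im| → ‖Gamma s‖ ≤ C * Real.exp (-θ * |s.im|) := by
    intro n
    induction n with
    | zero =>
      intro A B hA
      have hA : 0 < A := by simpa using hA
      have hcos : 0 < Real.cos θ :=
        Real.cos_pos_of_mem_Ioo ⟨by linarith [Real.pi_pos], hθ⟩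
      have hc : ContinuousOn (fun σ : ℝ => (1 / Real.cos θ) ^ σ * Real.Gamma σ) (Icc A B) := by
        intro σ hσ
        refine ContinuousAt.continuousWithinAt (ContinuousAt.mul ?_ ?_)
        · exact (Real.continuous_const_rpow (by positivity)).continuousAt
        · refine (Real.differentiableAt_Gamma fun m => ?_).continuousAt
          have : (0 : ℝ) ≤ m := m.cast_nonneg
          have := hσ.1
          exact ne_of_gt (by linarith)
      obtain ⟨C, hC⟩ := isCompact_Icc.exists_bound_of_continuousOn hc
      refine ⟨C, fun s h1 h2 _ => ?_⟩
      have hs : 0 < s.re := hA.trans_le h1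
      have hb := (le_abs_self _).trans (hC s.re ⟨h1, h2⟩)
      rw [mul_comm]
      rcases le_total 0 s.im with h | h
      · refine (norm_Gamma_le_exp_neg hs (θ := θ) (by rwa [abs_of_nonneg h0])).trans ?_
        rw [abs_of_nonneg h, neg_mul]
        gcongr
      · refine (norm_Gamma_le_exp_neg hs (θ := -θ) (by rwa [abs_neg, abs_of_nonneg h0])).trans ?_
        rw [abs_of_nonpos h, Real.cos_neg]
        simp only [neg_mul, mul_neg, neg_neg]
        gcongr
    | succ n ih =>
      intro A B hA
      obtain ⟨C, hC⟩ := ih (A + 1) (B + 1) (by push_cast at hA; linarith)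
      refine ⟨C, fun s h1 h2 h3 => ?_⟩
      have hs : 1 ≤ ‖s‖ := h3.trans (abs_im_le_norm s)
      have hs0 : s ≠ 0 := norm_pos_iff.1 (zero_lt_one.trans_le hs)
      have h := hC (s + 1) (by simpa using h1) (by simpa using h2) (by simpa using h3)
      rw [Gamma_add_one _ hs0, norm_mul] at h
      simp only [add_im, one_im, add_zero] at h
      exact (le_mul_of_one_le_left (norm_nonneg _) hs).trans h
  obtain ⟨n, hn⟩ := exists_nat_gt (-A)
  obtain ⟨C, hC⟩ := key n A B (by linarith)
  exact ⟨C, 1, hC⟩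

end GammaDecay

/-! ### Subexponential growth of ζ in vertical strips. -/

section ZetaGrowth

open Complex Set

theorem norm_ofReal_cpow_sub_le {x y : ℝ} {s : ℂ} (hx : 0 < x) (hs : 0 ≤ s.re)
    (hxy : x ≤ y) (hyx : y ≤ x + 1) :
    ‖(y : ℂ) ^ (-s) - (x : ℂ) ^ (-s)‖ ≤ ‖s‖ * x ^ (-s.re - 1) := by
  have hd : ∀ u ∈ Icc x (x + 1), HasDerivWithinAt (fun u : ℝ => (u : ℂ) ^ (-s))
      (-s * (u : ℂ) ^ (-s - 1)) (Icc x (x + 1)) u := by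
    intro u hu
    have := ((hasDerivAt_id (u : ℂ)).cpow_const (c := -s)
      (Or.inl (by simpa using hx.trans_le hu.1))).comp_ofReal
    simpa using this.hasDerivWithinAt
  have hb : ∀ u ∈ Icc x (x + 1), ‖-s * (u : ℂ) ^ (-s - 1)‖ ≤ ‖s‖ * x ^ (-s.re - 1) := by
    intro u hu
    rw [norm_mul, norm_neg, norm_cpow_eq_rpow_re_of_pos (hx.trans_le hu.1)]
    have : (-s - 1).re = -s.re - 1 := by simp
    rw [this]
    gcongr ?_ * ?_
    exact Real.rpow_le_rpow_of_nonpos hx hu.1 (by linarith)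
  have h := (convex_Icc x (x + 1)).norm_image_sub_le_of_norm_hasDerivWithin_le hd hb
    (left_mem_Icc.2 (by linarith)) ⟨hxy, hyx⟩
  refine h.trans (mul_le_of_le_one_right (by positivity) ?_)
  rw [Real.norm_of_nonneg (by linarith)]
  linarith

/-- The left side is `(1 - s)` times `x^{-s} - ∫_x^{x+1} u^{-s} du`, with the denominator cleared so
that `s = 1` is harmless. The bound is the mean value inequality for an antiderivative of the
integrand. -/
theorem norm_cpow_sub_integral_le {x : ℝ} {s : ℂ} (hx : 0 < x) (hs : 0 ≤ s.re) :
    ‖(1 - s) * (x : ℂ) ^ (-s) - ((x + 1 : ℝ) : ℂ) ^ (1 - s) + (x : ℂ) ^ (1 - s)‖ ≤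
      ‖1 - s‖ * (‖s‖ * x ^ (-s.re - 1)) := by
  have hd : ∀ u ∈ Icc x (x + 1), HasDerivWithinAt
      (fun u : ℝ => (1 - s) * (x : ℂ) ^ (-s) * (u : ℂ) - (u : ℂ) ^ (1 - s))
      (-((1 - s) * ((u : ℂ) ^ (-s) - (x : ℂ) ^ (-s)))) (Icc x (x + 1)) u := by
    intro u hu
    have h1 := ((hasDerivAt_id (u : ℂ)).cpow_const (c := 1 - s)
      (Or.inl (by simpa using hx.trans_le hu.1)))
    have h2 := (((hasDerivAt_id (u : ℂ)).const_mul ((1 - s) * (x : ℂ) ^ (-s))).sub h1).comp_ofReal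
    refine (h2.hasDerivWithinAt (s := Icc x (x + 1))).congr_deriv ?_
    simp only [id, show 1 - s - 1 = -s by ring]
    ring
  have hb : ∀ u ∈ Icc x (x + 1), ‖-((1 - s) * ((u : ℂ) ^ (-s) - (x : ℂ) ^ (-s)))‖ ≤
      ‖1 - s‖ * (‖s‖ * x ^ (-s.re - 1)) := by
    intro u hu
    rw [norm_neg, norm_mul]
    gcongr
    exact norm_ofReal_cpow_sub_le hx hs hu.1 hu.2
  have h := (convex_Icc x (x + 1)).norm_image_sub_le_of_norm_hasDerivWithin_le hd hb
    (left_mem_Icc.2 (by linarith)) (right_mem_Icc.2 (by linarith))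
  simp only [add_sub_cancel_left, norm_one, mul_one] at h
  refine le_trans (le_of_eq ?_) h
  congr 1
  push_cast
  ring

/-- The terms of the Euler-Maclaurin series of `(1 - s) ζ(s) + 1`. -/
noncomputable def zetaCorrection (n : ℕ) (s : ℂ) : ℂ :=
  (1 - s) * ((n + 1 : ℝ) : ℂ) ^ (-s) - ((n + 1 + 1 : ℝ) : ℂ) ^ (1 - s) +
    ((n + 1 : ℝ) : ℂ) ^ (1 - s)

theorem norm_zetaCorrection_le (n : ℕ) {s : ℂ} {σ : ℝ} (hσ : 0 ≤ σ) (hs : σ ≤ s.re) :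
    ‖zetaCorrection n s‖ ≤ ‖1 - s‖ * ‖s‖ * (n + 1 : ℝ) ^ (-(σ + 1)) := by
  refine (norm_cpow_sub_integral_le (x := n + 1) (by positivity) (hσ.trans hs)).trans ?_
  rw [mul_assoc]
  gcongr
  · have : (0 : ℝ) ≤ n := n.cast_nonneg
    linarith
  · linarith

theorem summable_nat_add_one_rpow {σ : ℝ} (hσ : 0 < σ) :
    Summable fun n : ℕ => (n + 1 : ℝ) ^ (-(σ + 1)) := by
  have := (summable_nat_add_iff 1).2 (Real.summable_nat_rpow.2 (show -(σ + 1) < -1 by linarith))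
  simpa using this

theorem summable_zetaCorrection {s : ℂ} (hs : 0 < s.re) :
    Summable fun n => zetaCorrection n s :=
  Summable.of_norm_bounded ((summable_nat_add_one_rpow hs).mul_left _)
    fun n => norm_zetaCorrection_le n hs.le le_rfl

theorem sum_range_zetaCorrection (N : ℕ) (s : ℂ) :
    ∑ n ∈ Finset.range N, zetaCorrection n s =
      (1 - s) * ∑ n ∈ Finset.range N, 1 / (n + 1 : ℂ) ^ s - ((N + 1 : ℝ) : ℂ) ^ (1 - s) + 1 := by
  induction N with
  | zero => simp
  | succ N ih =>
    rw [Finset.sum_range_succ, Finset.sum_range_succ, ih, zetaCorrection, cpow_neg]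
    push_cast
    ring

theorem tsum_zetaCorrection_of_one_lt_re {s : ℂ} (hs : 1 < s.re) :
    ∑' n, zetaCorrection n s = (1 - s) * riemannZeta s + 1 := by
  have h1 := (summable_zetaCorrection (by linarith : 0 < s.re)).hasSum.tendsto_sum_nat
  refine tendsto_nhds_unique h1 ?_
  simp_rw [sum_range_zetaCorrection]
  have hsum : Summable fun n : ℕ => 1 / (n + 1 : ℂ) ^ s := by
    simpa using (summable_nat_add_iff 1).2 (Complex.summable_one_div_nat_cpow.2 hs)
  have h2 := hsum.hasSum.tendsto_sum_nat
  rw [← zeta_eq_tsum_one_div_nat_add_one_cpow hs] at h2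
  have h3 : Tendsto (fun N : ℕ => ((N + 1 : ℝ) : ℂ) ^ (1 - s)) atTop (𝓝 0) := by
    rw [tendsto_zero_iff_norm_tendsto_zero]
    have : ∀ N : ℕ, ‖((N + 1 : ℝ) : ℂ) ^ (1 - s)‖ = (N + 1 : ℝ) ^ (-(s.re - 1)) := by
      intro N
      rw [norm_cpow_eq_rpow_re_of_pos (by positivity)]
      simp
    simp_rw [this]
    exact (tendsto_rpow_neg_atTop (by linarith)).comp
      (tendsto_atTop_add_const_right _ _ tendsto_natCast_atTop_atTop)
  simpa using ((h2.const_mul (1 - s)).sub h3).add_const 1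

theorem differentiable_zetaCorrection (n : ℕ) : Differentiable ℂ (zetaCorrection n) := by
  have h1 : ((n + 1 : ℝ) : ℂ) ≠ 0 := by exact_mod_cast n.succ_ne_zero
  have h2 : ((n + 1 + 1 : ℝ) : ℂ) ≠ 0 := by exact_mod_cast (n + 1).succ_ne_zero
  intro s
  unfold zetaCorrection
  refine DifferentiableAt.add (DifferentiableAt.sub (DifferentiableAt.mul (by fun_prop) ?_) ?_) ?_
  · exact DifferentiableAt.const_cpow (by fun_prop) (Or.inl h1)
  · exact DifferentiableAt.const_cpow (by fun_prop) (Or.inl h2)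
  · exact DifferentiableAt.const_cpow (by fun_prop) (Or.inl h1)

/-- Here `riemannZeta₁` is the entire function extending `(s - 1) ζ(s)`. The correction series
telescopes to the claim where `Re s > 1`, and it converges to an analytic function on `Re s > 0`, so
the identity propagates. -/
theorem riemannZeta₁_eq_one_sub_tsum {s : ℂ} (hs : 0 < s.re) :
    riemannZeta₁ s = 1 - ∑' n, zetaCorrection n s := by
  obtain ⟨σ, hσ0, hσ⟩ := exists_between (lt_min hs one_pos)
  set R := max ‖s‖ 2 + 1 with hR
  have hσs : σ < s.re := hσ.trans_le (min_le_left _ _)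
  have hσ1 : σ < 1 := hσ.trans_le (min_le_right _ _)
  -- Boundedness of `U` and the lower bound `σ` on real parts give one summable majorant for all
  -- terms; convexity gives connectedness; `U` contains both `s` and 2.
  set U : Set ℂ := {w | σ < w.re} ∩ Metric.ball 0 R
  have hU : IsOpen U := (isOpen_lt continuous_const continuous_re).inter Metric.isOpen_ball
  have hUc : IsPreconnected U :=
    ((convex_halfSpace_re_gt σ).inter (convex_ball 0 R)).isPreconnected
  have hd : DifferentiableOn ℂ (fun w => ∑' n, zetaCorrection n w) U := by
    refine differentiableOn_tsum_of_summable_norm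
      ((summable_nat_add_one_rpow hσ0).mul_left ((1 + R) * R))
      (fun n => (differentiable_zetaCorrection n).differentiableOn) hU ?_
    intro n w hw
    refine (norm_zetaCorrection_le n hσ0.le hw.1.le).trans ?_
    have hw2 : ‖w‖ < R := by simpa using hw.2
    have : ‖1 - w‖ ≤ 1 + R := (norm_sub_le _ _).trans (by simpa using hw2.le)
    gcongr
  have h1 : AnalyticOnNhd ℂ riemannZeta₁ U :=
    differentiable_riemannZeta₁.differentiableOn.analyticOnNhd hU
  have h2 : AnalyticOnNhd ℂ (fun w => 1 - ∑' n, zetaCorrection n w) U :=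
    ((differentiableOn_const _).sub hd).analyticOnNhd hU
  have h2U : (2 : ℂ) ∈ U := by
    refine ⟨?_, ?_⟩
    · simp
      linarith
    · simp [hR]
      have := le_max_right ‖s‖ 2
      linarith
  have hsU : s ∈ U := by
    refine ⟨hσs, ?_⟩
    simp [hR]
    have := le_max_left ‖s‖ 2
    linarith
  refine h1.eqOn_of_preconnected_of_eventuallyEq h2 hUc h2U ?_ hsU
  have : {w : ℂ | 1 < w.re} ∈ 𝓝 (2 : ℂ) :=
    (isOpen_lt continuous_const continuous_re).mem_nhds (by simp)
  filter_upwards [this] with w hw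
  have hw' : 1 < w.re := hw
  have hw1 : w ≠ 1 := by
    rintro rfl
    simp at hw'
  rw [tsum_zetaCorrection_of_one_lt_re hw, riemannZeta_eq_inv_sub_mul hw1]
  have : w - 1 ≠ 0 := sub_ne_zero.2 hw1
  field_simp
  ring

theorem exists_norm_riemannZeta_le : ∃ C : ℝ, ∀ s : ℂ, 1 / 2 ≤ s.re → 1 ≤ |s.im| →
    ‖riemannZeta s‖ ≤ 1 + C * ‖s‖ := by
  refine ⟨∑' n : ℕ, (n + 1 : ℝ) ^ (-((1 / 2 : ℝ) + 1)), fun s hs hi => ?_⟩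
  set C := ∑' n : ℕ, (n + 1 : ℝ) ^ (-((1 / 2 : ℝ) + 1))
  have hsum := summable_nat_add_one_rpow (σ := 1 / 2) (by norm_num)
  have h1 : 1 ≤ ‖s - 1‖ := hi.trans (by simpa using abs_im_le_norm (s - 1))
  have hs1 : s ≠ 1 := by
    rintro rfl
    simp at h1
    linarith
  have hB : ‖∑' n, zetaCorrection n s‖ ≤ ‖1 - s‖ * ‖s‖ * C := by
    refine tsum_of_norm_bounded (hsum.hasSum.mul_left _) fun n => ?_
    exact norm_zetaCorrection_le n (by norm_num) hs
  rw [riemannZeta_eq_inv_sub_mul hs1, riemannZeta₁_eq_one_sub_tsum (by linarith), norm_mul,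
    norm_inv, inv_mul_le_iff₀ (by linarith)]
  refine (norm_sub_le _ _).trans ?_
  rw [norm_one, norm_sub_rev 1 s] at *
  nlinarith

theorem stripExpBound_norm_le_mul_norm {f : ℂ → ℂ} {A B C T : ℝ}
    (h : ∀ s : ℂ, A ≤ s.re → s.re ≤ B → T ≤ |s.im| → ‖f s‖ ≤ 1 + C * ‖s‖) {ε : ℝ} (hε : 0 < ε) :
    StripExpBound f A B ε := by
  refine ⟨1 + |C| * (|A| + |B| + 1 / ε), T, fun s hA hB hT => (h s hA hB hT).trans ?_⟩
  have h1 : ‖s‖ ≤ |A| + |B| + |s.im| := by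
    refine (norm_le_abs_re_add_abs_im s).trans ?_
    gcongr
    rw [abs_le]
    constructor
    · linarith [neg_abs_le A, abs_nonneg B]
    · linarith [le_abs_self B, abs_nonneg A]
  have h2 : 1 + ε * |s.im| ≤ Real.exp (ε * |s.im|) := by
    linarith [Real.add_one_le_exp (ε * |s.im|)]
  have h3 : 1 ≤ Real.exp (ε * |s.im|) := Real.one_le_exp (by positivity)
  have h4 : |s.im| ≤ 1 / ε * Real.exp (ε * |s.im|) := by
    rw [one_div, inv_mul_eq_div, le_div_iff₀ hε]
    linarith
  have h5 : ‖s‖ ≤ (|A| + |B| + 1 / ε) * Real.exp (ε * |s.im|) := by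
    have : |A| + |B| ≤ (|A| + |B|) * Real.exp (ε * |s.im|) :=
      le_mul_of_one_le_right (by positivity) h3
    linarith
  calc 1 + C * ‖s‖ ≤ 1 * Real.exp (ε * |s.im|) +
        |C| * ((|A| + |B| + 1 / ε) * Real.exp (ε * |s.im|)) := by
        rw [one_mul]
        gcongr
        exact le_abs_self C
    _ = _ := by ring

theorem norm_cos_le_exp_abs_im (z : ℂ) : ‖cos z‖ ≤ Real.exp |z.im| := by
  rw [Complex.cos, norm_div, Complex.norm_ofNat, div_le_iff₀ two_pos]
  refine (norm_add_le _ _).trans ?_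
  rw [norm_exp, norm_exp]
  have h1 : Real.exp (z * I).re ≤ Real.exp |z.im| := by
    gcongr
    simpa using neg_le_abs z.im
  have h2 : Real.exp (-z * I).re ≤ Real.exp |z.im| := by
    gcongr
    simpa using le_abs_self z.im
  linarith

theorem stripExpBound_cos (A B : ℝ) :
    StripExpBound (fun s => cos (Real.pi * s / 2)) A B (Real.pi / 2) := by
  refine ⟨1, 0, fun s _ _ _ => (norm_cos_le_exp_abs_im _).trans (le_of_eq ?_)⟩
  have : (Real.pi * s / 2 : ℂ).im = Real.pi / 2 * s.im := by
    rw [show (Real.pi * s / 2 : ℂ) = ((Real.pi / 2 : ℝ) : ℂ) * s by push_cast; ring, im_ofReal_mul]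
  rw [this, abs_mul, abs_of_pos (by positivity), one_mul]

theorem stripExpBound_const_cpow (A B : ℝ) {x : ℝ} (hx : 0 < x) :
    StripExpBound (fun s => (x : ℂ) ^ (-s)) A B 0 := by
  have hc : ContinuousOn (fun σ : ℝ => x ^ (-σ)) (Icc A B) :=
    ((Real.continuous_const_rpow hx.ne').comp continuous_neg).continuousOn
  obtain ⟨C, hC⟩ := isCompact_Icc.exists_bound_of_continuousOn hc
  refine ⟨C, 0, fun s h1 h2 _ => ?_⟩
  rw [norm_cpow_eq_rpow_re_of_pos hx, zero_mul, Real.exp_zero, mul_one]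
  exact (le_abs_self _).trans (hC s.re ⟨h1, h2⟩)

/-- On `Re s ≥ 1/2` the growth is linear. To the left, the functional equation expresses ζ through
its values on the right, and the growth `π/2` of the cosine is almost cancelled by the decay of Γ.
-/
theorem stripExpBound_riemannZeta (A B : ℝ) {ε : ℝ} (hε : 0 < ε) :
    StripExpBound riemannZeta A B ε := by
  obtain ⟨K, hK⟩ := exists_norm_riemannZeta_le
  have right : ∀ {B ε : ℝ}, 0 < ε → StripExpBound riemannZeta (1 / 2) B ε := fun hε =>
    stripExpBound_norm_le_mul_norm (T := 1) (fun s h1 _ h3 => hK s h1 h3) hε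
  obtain ⟨C₁, T₁, h₁⟩ := right (B := B) hε
  -- Γ is used with rate `π/2 - η`, so Γ times cosine costs at most `ε/2`, and ζ on the right costs
  -- the other half. The cap `π/4` keeps `π/2 - η` nonnegative.
  set η := min (ε / 2) (Real.pi / 4) with hη
  have hη0 : 0 < η := lt_min (by positivity) (by positivity)
  have hη1 : η ≤ ε / 2 := min_le_left _ _
  have hη2 : η ≤ Real.pi / 4 := min_le_right _ _
  have hG := stripExpBound_Gamma (1 / 2) (1 - A) (θ := Real.pi / 2 - η)
    (by linarith [Real.pi_pos]) (by linarith)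
  obtain ⟨C₂, T₂, h₂⟩ := ((((stripExpBound_const_cpow (1 / 2) (1 - A) Real.two_pi_pos).mul hG).mul
    (stripExpBound_cos _ _)).mul (right (B := 1 - A) (half_pos hε))).mono_right (r' := ε)
      (by linarith)
  refine ⟨max |C₁| (2 * |C₂|), max (max T₁ T₂) 1, fun s hA hB hT => ?_⟩
  have hT1 : T₁ ≤ |s.im| := ((le_max_left _ _).trans (le_max_left _ _)).trans hT
  have hT2 : T₂ ≤ |s.im| := ((le_max_right _ _).trans (le_max_left _ _)).trans hT
  have hT3 : 1 ≤ |s.im| := (le_max_right _ _).trans hT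
  rcases le_total (1 / 2) s.re with h | h
  · refine (h₁ s h hB hT1).trans ?_
    gcongr
    exact (le_abs_self _).trans (le_max_left _ _)
  · have him : (1 - s).im = -s.im := by simp
    have hne : ∀ x : ℝ, 1 - s ≠ x := by
      intro x hx
      have := congrArg im hx
      rw [him, ofReal_im, neg_eq_zero] at this
      rw [this] at hT3
      simp at hT3
      linarith
    have hfe := riemannZeta_one_sub (s := 1 - s) (fun n => by exact_mod_cast hne (-n))
      (by exact_mod_cast hne 1)
    rw [sub_sub_cancel] at hfe
    have hb := h₂ (1 - s) (by simp; linarith) (by simp; linarith) (by rwa [him, abs_neg])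
    rw [him, abs_neg] at hb
    push_cast at hb
    rw [hfe, show ∀ a b c d : ℂ, 2 * a * b * c * d = 2 * (a * b * c * d) by intros; ring, norm_mul,
      Complex.norm_ofNat]
    calc 2 * _ ≤ 2 * (C₂ * Real.exp (ε * |s.im|)) := by gcongr
      _ ≤ 2 * |C₂| * Real.exp (ε * |s.im|) := by
        rw [← mul_assoc]
        gcongr
        exact le_abs_self _
      _ ≤ _ := by
        gcongr
        exact le_max_right _ _

end ZetaGrowth

/-! ### The multiple sum as an inverse Mellin integral. -/

section InverseMellin

open Complex MeasureTheory Set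

theorem hasSum_fin_prod {β : Type*} {ℓ : ℕ} {f : Fin ℓ → β → ℂ} {c : Fin ℓ → ℂ}
    (hn : ∀ j, Summable fun n => ‖f j n‖) (h : ∀ j, HasSum (f j) (c j)) :
    (Summable fun δ : Fin ℓ → β => ‖∏ j, f j (δ j)‖) ∧
      HasSum (fun δ : Fin ℓ → β => ∏ j, f j (δ j)) (∏ j, c j) := by
  induction ℓ with
  | zero => exact ⟨(hasSum_fintype _).summable, by simp⟩
  | succ ℓ ih =>
    obtain ⟨h1, h2⟩ := ih (fun j => hn j.succ) (fun j => h j.succ)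
    have hs : Summable fun p : β × (Fin ℓ → β) => ‖f 0 p.1 * ∏ j, f (Fin.succ j) (p.2 j)‖ :=
      Summable.mul_norm (f := f 0) (g := fun δ : Fin ℓ → β => ∏ j, f (Fin.succ j) (δ j)) (hn 0) h1
    have hsum := (h 0).mul h2 hs.of_norm
    constructor
    · rw [← (Fin.consEquiv fun _ : Fin (ℓ + 1) => β).summable_iff]
      simpa [Function.comp_def, Fin.prod_univ_succ, Fin.consEquiv] using hs
    · rw [← (Fin.consEquiv fun _ : Fin (ℓ + 1) => β).hasSum_iff]
      simpa [Function.comp_def, Fin.prod_univ_succ, Fin.consEquiv] using hsum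

theorem hasSum_pnat_cpow_neg {s : ℂ} (hs : 1 < s.re) :
    (Summable fun n : ℕ+ => ‖((n : ℕ) : ℂ) ^ (-s)‖) ∧
      HasSum (fun n : ℕ+ => ((n : ℕ) : ℂ) ^ (-s)) (riemannZeta s) := by
  have hsum : Summable fun n : ℕ => ‖1 / (n : ℂ) ^ s‖ := (Complex.summable_one_div_nat_cpow.2 hs).norm
  have h1 : Summable fun n : ℕ+ => ‖((n : ℕ) : ℂ) ^ (-s)‖ := by
    simpa [cpow_neg, Function.comp_def] using hsum.comp_injective PNat.coe_injective
  refine ⟨h1, ?_⟩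
  rw [zeta_eq_tsum_one_div_nat_add_one_cpow hs]
  have := tsum_pnat_eq_tsum_succ (f := fun n : ℕ => (n : ℂ) ^ (-s))
  have h2 := h1.of_norm.hasSum
  rw [this] at h2
  simpa [cpow_neg] using h2

theorem integrable_comp_vertical_of_stripExpBound {f : ℂ → ℂ} {c r : ℝ} (hr : r < 0)
    (hf : StripExpBound f c c r) (hc : Continuous fun y : ℝ => f (c + y * I)) :
    Integrable fun y : ℝ => f (c + y * I) := by
  obtain ⟨C, T, h⟩ := hf
  have hb : ∀ y : ℝ, T ≤ |y| → ‖f (c + y * I)‖ ≤ C * Real.exp (r * |y|) := fun y hy => by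
    simpa using h (c + y * I) (by simp) (by simp) (by simpa using hy)
  refine hc.locallyIntegrable.integrable_of_isBigO_atBot_atTop
    (g := fun y => Real.exp (-r * y)) (g' := fun y => Real.exp (r * y)) ?_ ?_ ?_ ?_
  · refine IsBigO.of_bound C ?_
    filter_upwards [eventually_le_atBot 0, eventually_le_atBot (-T)] with y h0 hT
    have := hb y (by rw [abs_of_nonpos h0]; linarith)
    rwa [abs_of_nonpos h0, mul_neg, ← neg_mul,
      ← Real.norm_of_nonneg (Real.exp_nonneg (-r * y))] at this
  · exact ⟨Iic 0, Iic_mem_atBot 0, integrableOn_exp_mul_Iic (neg_pos.2 hr) 0⟩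
  · refine IsBigO.of_bound C ?_
    filter_upwards [eventually_ge_atTop 0, eventually_ge_atTop T] with y h0 hT
    have := hb y (by rwa [abs_of_nonneg h0])
    rwa [abs_of_nonneg h0, ← Real.norm_of_nonneg (Real.exp_nonneg (r * y))] at this
  · exact ⟨Ioi 0, Ioi_mem_atTop 0, integrableOn_exp_mul_Ioi hr 0⟩

theorem differentiableAt_Gamma_of_re_pos {s : ℂ} (hs : 0 < s.re) : DifferentiableAt ℂ Gamma s := by
  refine differentiableAt_Gamma _ fun m hm => ?_
  have : (0 : ℝ) ≤ m := m.cast_nonneg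
  rw [hm] at hs
  simp at hs
  linarith

theorem continuous_Gamma_vertical {c : ℝ} (hc : 0 < c) :
    Continuous fun y : ℝ => Gamma (c + y * I) := by
  refine continuous_iff_continuousAt.2 fun y => ?_
  have : ContinuousAt Gamma (c + y * I) :=
    (differentiableAt_Gamma_of_re_pos (by simpa using hc)).continuousAt
  exact ContinuousAt.comp (f := fun y : ℝ => (c + y * I : ℂ)) this (by fun_prop)

theorem integrable_Gamma_vertical {c : ℝ} (hc : 0 < c) :
    Integrable fun y : ℝ => Gamma (c + y * I) :=
  integrable_comp_vertical_of_stripExpBound (r := -1) (by norm_num)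
    (stripExpBound_Gamma c c zero_le_one (by linarith [Real.pi_gt_three]))
    (continuous_Gamma_vertical hc)

/-- The Cahen-Mellin integral. -/
theorem integral_Gamma_mul_cpow_neg {c x : ℝ} (hc : 0 < c) (hx : 0 < x) :
    ∫ y : ℝ, (x : ℂ) ^ (-(c + y * I : ℂ)) * Gamma (c + y * I) =
      2 * Real.pi * exp (-x) := by
  have hm : ∀ s : ℂ, mellin (fun t : ℝ => exp (-(t : ℂ))) s =
      ∫ t : ℝ in Ioi 0, (t : ℂ) ^ (s - 1) * exp (-t) := fun s => rfl
  have hG : ∀ y : ℝ, mellin (fun t : ℝ => exp (-(t : ℂ))) (c + y * I) = Gamma (c + y * I) := by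
    intro y
    rw [hm, Gamma_eq_integral (by simpa using hc), GammaIntegral]
    refine integral_congr_ae (Eventually.of_forall fun t => ?_)
    simp [mul_comm]
  have h := mellinInv_mellin_eq c (fun t : ℝ => exp (-(t : ℂ))) hx ?_ ?_ (by fun_prop)
  · rw [mellinInv] at h
    simp only [hG, smul_eq_mul] at h
    rw [← h, Complex.real_smul]
    simp only [ofReal_div, ofReal_mul, ofReal_one, ofReal_ofNat]
    rw [← mul_assoc, mul_one_div_cancel (by simp), one_mul]
  · have := integrableOn_cpow_mul_exp_neg_mul (a := (c : ℂ) - 1) (r := 1) (by simpa using hc)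
      (by simp)
    simpa [MellinConvergent] using this
  · rw [VerticalIntegrable]
    simp only [hG]
    exact integrable_Gamma_vertical hc

/-- The Mellin transform of `Z_α^{[ℓ]}`. -/
noncomputable def ZMellin {ℓ : ℕ} (α : Fin ℓ → ℂ) (s : ℂ) : ℂ :=
  Gamma s * ∏ j, riemannZeta (s + 1 - α j)

/-- Γ contributes rate `-1`, allowed because `1 < π/2`, and all the ζ factors together are held to
`1/2`. -/
theorem stripExpBound_ZMellin {ℓ : ℕ} (α : Fin ℓ → ℂ) (A B : ℝ) :
    StripExpBound (ZMellin α) A B (-1 / 2) := by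
  have h := (stripExpBound_Gamma A B zero_le_one (by linarith [Real.pi_gt_three])).mul
    (StripExpBound.prod Finset.univ (f := fun j s => riemannZeta (s + (1 - α j))) (ε := 1 / 2)
      (fun j _ ε hε => (stripExpBound_riemannZeta _ _ hε).comp_add_const _ hε.le) (by norm_num))
  convert! h using 1
  · ext s
    simp [ZMellin, add_sub_assoc]
  · norm_num

theorem prod_natCast_cpow {ι : Type*} (S : Finset ι) (n : ι → ℕ) (s : ℂ) :
    ((∏ j ∈ S, (n j : ℝ) : ℝ) : ℂ) ^ s = ∏ j ∈ S, (n j : ℂ) ^ s := by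
  classical
  induction S using Finset.induction_on with
  | empty => simp
  | insert i S hi ih =>
    rw [Finset.prod_insert hi, Finset.prod_insert hi, ofReal_mul, mul_cpow_ofReal_nonneg
      (by positivity) (by positivity), ih]
    simp

theorem cpow_mul_prod_mul_cpow {ℓ : ℕ} (α : Fin ℓ → ℂ) {t : ℝ} (ht : 0 < t) (δ : Fin ℓ → ℕ+)
    (s : ℂ) :
    (∏ j, ((δ j : ℕ) : ℂ) ^ (α j - 1)) * (((∏ j, ((δ j : ℕ) : ℝ)) * t : ℝ) : ℂ) ^ (-s) =
      (t : ℂ) ^ (-s) * ∏ j, ((δ j : ℕ) : ℂ) ^ (-(s + 1 - α j)) := by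
  rw [ofReal_mul, mul_cpow_ofReal_nonneg (by positivity) ht.le, prod_natCast_cpow, ← mul_assoc,
    ← Finset.prod_mul_distrib, mul_comm]
  congr 1
  refine Finset.prod_congr rfl fun j _ => ?_
  rw [← cpow_add _ _ (by exact_mod_cast (δ j).ne_zero)]
  congr 1
  ring

/-- Expand each exponential by the Cahen-Mellin integral and exchange sum and integral. On `Re s =
c` every ζ argument has real part above 1, so the Dirichlet series converge absolutely. -/
theorem hasSum_ZTerm {ℓ : ℕ} (α : Fin ℓ → ℂ) {c t : ℝ} (hc : 0 < c) (hα : ∀ j, (α j).re < c)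
    (ht : 0 < t) :
    HasSum (fun δ => 2 * Real.pi * ZTerm α t δ)
      (∫ y : ℝ, (t : ℂ) ^ (-(c + y * I : ℂ)) * ZMellin α (c + y * I)) := by
  have hs : ∀ (y : ℝ) (j : Fin ℓ), 1 < ((c + y * I : ℂ) + 1 - α j).re := by
    intro y j
    have := hα j
    simp
    linarith
  have hprod := fun y : ℝ => hasSum_fin_prod
    (fun j : Fin ℓ => (hasSum_pnat_cpow_neg (hs y j)).1) (fun j => (hasSum_pnat_cpow_neg (hs y j)).2)
  set f : (Fin ℓ → ℕ+) → ℝ → ℂ := fun δ y => (∏ j, ((δ j : ℕ) : ℂ) ^ (α j - 1)) *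
    ((((∏ j, ((δ j : ℕ) : ℝ)) * t : ℝ) : ℂ) ^ (-(c + y * I : ℂ)) * Gamma (c + y * I)) with hf
  have hx : ∀ δ : Fin ℓ → ℕ+, 0 < (∏ j, ((δ j : ℕ) : ℝ)) * t := fun δ =>
    mul_pos (Finset.prod_pos fun j _ => by exact_mod_cast (δ j).pos) ht
  have hf' : ∀ δ y, f δ y = (t : ℂ) ^ (-(c + y * I : ℂ)) * Gamma (c + y * I) *
      ∏ j, ((δ j : ℕ) : ℂ) ^ (-((c + y * I : ℂ) + 1 - α j)) := by
    intro δ y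
    simp only [hf]
    rw [← mul_assoc, cpow_mul_prod_mul_cpow α ht]
    ring
  -- The modulus of the Dirichlet factor does not depend on `y`. It is written at `y = 0` so that
  -- `hprod 0` gives its summability.
  have hnorm : ∀ δ y, ‖f δ y‖ = ‖∏ j, ((δ j : ℕ) : ℂ) ^ (-((c + (0 : ℝ) * I : ℂ) + 1 - α j))‖ *
      (t ^ (-c) * ‖Gamma (c + y * I)‖) := by
    intro δ y
    rw [hf', norm_mul, norm_mul, norm_cpow_eq_rpow_re_of_pos ht, norm_prod, norm_prod, mul_comm]
    congr 1
    · refine Finset.prod_congr rfl fun j _ => ?_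
      rw [norm_natCast_cpow_of_pos (δ j).pos, norm_natCast_cpow_of_pos (δ j).pos]
      simp
    · simp
  have hcont : ∀ δ, Continuous (f δ) := by
    intro δ
    refine continuous_const.mul (Continuous.mul ?_ (continuous_Gamma_vertical hc))
    exact Continuous.const_cpow (by fun_prop) (Or.inl (by exact_mod_cast (hx δ).ne'))
  have hG := integrable_Gamma_vertical hc
  have hint : ∀ δ, Integrable (f δ) := by
    intro δ
    refine Integrable.mono' ((hG.norm.const_mul (t ^ (-c))).const_mul
      ‖∏ j, ((δ j : ℕ) : ℂ) ^ (-((c + (0 : ℝ) * I : ℂ) + 1 - α j))‖)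
      (hcont δ).aestronglyMeasurable (Eventually.of_forall fun y => (hnorm δ y).le)
  have hsum : Summable fun δ => ∫ y, ‖f δ y‖ := by
    simp_rw [hnorm, integral_const_mul]
    exact (hprod 0).1.mul_right _
  have h := hasSum_integral_of_summable_integral_norm hint hsum
  have e1 : ∀ δ, ∫ y, f δ y = 2 * Real.pi * ZTerm α t δ := by
    intro δ
    simp only [hf]
    rw [integral_const_mul, integral_Gamma_mul_cpow_neg hc (hx δ), ZTerm]
    push_cast
    ring
  have e2 : ∀ y, ∑' δ, f δ y = (t : ℂ) ^ (-(c + y * I : ℂ)) * ZMellin α (c + y * I) := by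
    intro y
    simp_rw [hf' _ y]
    rw [((hprod y).2.mul_left _).tsum_eq, ZMellin, mul_assoc]
  simpa only [e1, e2] using h

end InverseMellin

/-! ### A residue theorem for vertical strips. -/

section ResidueTheorem

open Complex MeasureTheory Set

/-- The principal part `∑ d_k (s - p)^{-(k+1)}` of order at most `m + 1` at `p`. -/
noncomputable def principalPart (p : ℂ) (d : ℕ → ℂ) (m : ℕ) (s : ℂ) : ℂ :=
  ∑ k ∈ Finset.range (m + 1), d k * ((s - p) ^ (k + 1))⁻¹

/-- The filter of points of the strip `x₁ ≤ Re s ≤ x₂` tending to infinity. -/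
def stripInfty (x₁ x₂ : ℝ) : Filter ℂ :=
  comap (fun s : ℂ => |s.im|) atTop ⊓ 𝓟 {s | x₁ ≤ s.re ∧ s.re ≤ x₂}

theorem tendsto_sub_cobounded_of_abs_im {ι : Type*} {l : Filter ι} {f : ι → ℂ} (p : ℂ)
    (h : Tendsto (fun i => |(f i).im|) l atTop) :
    Tendsto (fun i => f i - p) l (Bornology.cobounded ℂ) := by
  rw [← tendsto_norm_atTop_iff_cobounded]
  refine tendsto_atTop_mono (fun i => ?_) (tendsto_atTop_add_const_right l (-|p.im|) h)
  have h1 := abs_im_le_norm (f i - p)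
  have h2 := abs_sub_abs_le_abs_sub (f i).im p.im
  rw [sub_im] at h1
  linarith

theorem tendsto_inv_sub_pow_of_abs_im {ι : Type*} {l : Filter ι} {f : ι → ℂ} (p : ℂ) (k : ℕ)
    (h : Tendsto (fun i => |(f i).im|) l atTop) :
    Tendsto (fun i => ((f i - p) ^ (k + 1))⁻¹) l (𝓝 0) := by
  have := (tendsto_inv₀_cobounded.comp (tendsto_sub_cobounded_of_abs_im p h)).pow (k + 1)
  simpa [Function.comp_def] using this

theorem tendsto_principalPart_stripInfty (p : ℂ) (d : ℕ → ℂ) (m : ℕ) (x₁ x₂ : ℝ) :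
    Tendsto (principalPart p d m) (stripInfty x₁ x₂) (𝓝 0) := by
  have h : Tendsto (fun s : ℂ => |s.im|) (stripInfty x₁ x₂) atTop :=
    tendsto_comap.mono_left inf_le_left
  have := tendsto_finsetSum (Finset.range (m + 1)) fun k _ =>
    (tendsto_inv_sub_pow_of_abs_im (f := fun s => s) p k h).const_mul (d k)
  rw [show principalPart p d m = fun s => ∑ k ∈ Finset.range (m + 1),
    d k * ((s - p) ^ (k + 1))⁻¹ from rfl]
  simpa using this

theorem differentiableAt_principalPart {p s : ℂ} (d : ℕ → ℂ) (m : ℕ) (hs : s ≠ p) :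
    DifferentiableAt ℂ (principalPart p d m) s := by
  have hsp : s - p ≠ 0 := sub_ne_zero.2 hs
  unfold principalPart
  refine DifferentiableAt.fun_sum fun k _ => ?_
  have h : DifferentiableAt ℂ (fun s => ((s - p) ^ (k + 1))⁻¹) s :=
    DifferentiableAt.fun_inv (by fun_prop) (pow_ne_zero _ hsp)
  exact h.const_mul (d k)

/-- A primitive of `1/(u + iw)` along a vertical line that avoids any choice of branch of the
complex logarithm and works for both signs of `u`. -/
theorem hasDerivAt_arctan_sub_log {u : ℝ} (hu : u ≠ 0) (w : ℝ) :
    HasDerivAt (fun w : ℝ => ((Real.arctan (w / u) : ℝ) : ℂ) -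
      I / 2 * ((Real.log (u ^ 2 + w ^ 2) : ℝ) : ℂ)) ((u + w * I : ℂ)⁻¹) w := by
  have hpos : 0 < u ^ 2 + w ^ 2 := by positivity
  have h1 : HasDerivAt (fun w : ℝ => Real.arctan (w / u)) (1 / (1 + (w / u) ^ 2) * (1 / u)) w :=
    ((hasDerivAt_id w).div_const u).arctan
  have h2 : HasDerivAt (fun w : ℝ => Real.log (u ^ 2 + w ^ 2)) (2 * w / (u ^ 2 + w ^ 2)) w := by
    have := (((hasDerivAt_id w).pow 2).const_add (u ^ 2)).log hpos.ne'
    simpa using! this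
  refine (h1.ofReal_comp.sub (h2.ofReal_comp.const_mul (I / 2))).congr_deriv ?_
  have hne : (u + w * I : ℂ) ≠ 0 := by
    intro h
    have := congrArg re h
    simp at this
    exact hu this
  have hc : (u : ℂ) ^ 2 + (w : ℂ) ^ 2 ≠ 0 := by exact_mod_cast hpos.ne'
  have huc : (u : ℂ) ≠ 0 := by exact_mod_cast hu
  have h3 : 1 / (1 + (w / u) ^ 2) * (1 / u) = u / (u ^ 2 + w ^ 2) := by
    field_simp
  rw [h3]
  refine eq_inv_of_mul_eq_one_left ?_
  push_cast
  field_simp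
  ring_nf
  simp

theorem tendsto_log_sub_log {ι : Type*} {l : Filter ι} (u v : ℝ) {w : ι → ℝ}
    (hv : v ≠ 0) (hu : u ≠ 0) (hw : Tendsto (fun i => w i ^ 2) l atTop) :
    Tendsto (fun i => Real.log (u ^ 2 + w i ^ 2) - Real.log (v ^ 2 + w i ^ 2)) l (𝓝 0) := by
  have h1 : Tendsto (fun i => 1 + (u ^ 2 - v ^ 2) / (v ^ 2 + w i ^ 2)) l (𝓝 1) := by
    have := (tendsto_const_nhds (x := u ^ 2 - v ^ 2)).div_atTop
      (tendsto_atTop_add_const_left l (v ^ 2) hw)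
    simpa using this.const_add 1
  have h2 := ((Real.continuousAt_log one_ne_zero).tendsto.comp h1)
  rw [Real.log_one] at h2
  refine h2.congr fun i => ?_
  have hu' : 0 < u ^ 2 + w i ^ 2 := by positivity
  have hv' : 0 < v ^ 2 + w i ^ 2 := by positivity
  rw [Function.comp_apply, ← Real.log_div hu'.ne' hv'.ne']
  congr 1
  field_simp
  ring

/-- The logarithms of the two lines cancel in the limit. The arctangents contribute `π` on the right
line and `-π` on the left one, where the divisor is negative. -/
theorem tendsto_integral_inv_sub {x₁ x₂ : ℝ} {p : ℂ} (h₁ : x₁ < p.re) (h₂ : p.re < x₂) :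
    Tendsto (fun T : ℝ => ∫ y in -T..T,
      ((x₂ + y * I - p : ℂ)⁻¹ - (x₁ + y * I - p : ℂ)⁻¹)) atTop (𝓝 (2 * Real.pi)) := by
  have hu₁ : x₁ - p.re < 0 := by linarith
  have hu₂ : 0 < x₂ - p.re := by linarith
  set A : ℝ → ℝ → ℂ := fun u w => ((Real.arctan (w / u) : ℝ) : ℂ) -
      I / 2 * ((Real.log (u ^ 2 + w ^ 2) : ℝ) : ℂ) with hA
  have hd : ∀ {x : ℝ}, x - p.re ≠ 0 → ∀ y : ℝ,
      HasDerivAt (fun y : ℝ => A (x - p.re) (y - p.im)) ((x + y * I - p : ℂ)⁻¹) y := by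
    intro x hx y
    have := (hasDerivAt_arctan_sub_log hx (y - p.im)).comp_sub_const y p.im
    refine this.congr_deriv ?_
    congr 1
    apply Complex.ext <;> simp
  set P : ℝ → ℂ := fun y => A (x₂ - p.re) (y - p.im) - A (x₁ - p.re) (y - p.im) with hP
  have hcont : ∀ {x : ℝ}, x - p.re ≠ 0 → Continuous fun y : ℝ => ((x + y * I - p : ℂ)⁻¹) := by
    intro x hx
    refine Continuous.inv₀ (by fun_prop) fun y h => hx ?_
    simpa using congrArg re h
  have hint : ∀ T : ℝ, ∫ y in -T..T, ((x₂ + y * I - p : ℂ)⁻¹ - (x₁ + y * I - p : ℂ)⁻¹) =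
      P T - P (-T) := fun T => by
    refine intervalIntegral.integral_eq_sub_of_hasDerivAt
      (fun y _ => (hd hu₂.ne' y).sub (hd hu₁.ne y)) ?_
    exact ((hcont hu₂.ne').sub (hcont hu₁.ne)).intervalIntegrable _ _
  simp_rw [hint]
  have hPeq : ∀ y, P y = ((Real.arctan ((y - p.im) / (x₂ - p.re)) -
      Real.arctan ((y - p.im) / (x₁ - p.re)) : ℝ) : ℂ) -
      I / 2 * ((Real.log ((x₂ - p.re) ^ 2 + (y - p.im) ^ 2) -
        Real.log ((x₁ - p.re) ^ 2 + (y - p.im) ^ 2) : ℝ) : ℂ) := by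
    intro y
    simp only [hP, hA]
    push_cast
    ring
  have hlim : ∀ {l : Filter ℝ} {c : ℝ}, Tendsto (fun y : ℝ => (y - p.im) ^ 2) l atTop →
      Tendsto (fun y : ℝ => Real.arctan ((y - p.im) / (x₂ - p.re)) -
        Real.arctan ((y - p.im) / (x₁ - p.re))) l (𝓝 c) → Tendsto P l (𝓝 c) := by
    intro l c hl hc
    have h1 := (continuous_ofReal.tendsto c).comp hc
    have h2 := (continuous_ofReal.tendsto 0).comp (tendsto_log_sub_log _ _ hu₁.ne hu₂.ne' hl)
    have := h1.sub (h2.const_mul (I / 2))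
    rw [ofReal_zero, mul_zero, sub_zero] at this
    exact this.congr fun y => (hPeq y).symm
  have hT : Tendsto (fun y : ℝ => y - p.im) atTop atTop := tendsto_atTop_add_const_right _ _ tendsto_id
  have hB : Tendsto (fun y : ℝ => y - p.im) atBot atBot := tendsto_atBot_add_const_right _ _ tendsto_id
  have htop : Tendsto P atTop (𝓝 (Real.pi : ℝ)) := by
    refine hlim ((tendsto_pow_atTop two_ne_zero).comp hT) ?_
    have a1 := (tendsto_nhds_of_tendsto_nhdsWithin Real.tendsto_arctan_atTop).comp
      (hT.atTop_div_const hu₂)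
    have a2 := (tendsto_nhds_of_tendsto_nhdsWithin Real.tendsto_arctan_atBot).comp
      (hT.atTop_div_const_of_neg hu₁)
    have := a1.sub a2
    rwa [show Real.pi / 2 - -(Real.pi / 2) = Real.pi by ring] at this
  have hbot : Tendsto P atBot (𝓝 ((-Real.pi : ℝ) : ℂ)) := by
    refine hlim ?_ ?_
    · have := (tendsto_pow_atTop (α := ℝ) two_ne_zero).comp (tendsto_neg_atBot_atTop.comp hB)
      exact this.congr fun y => neg_sq _
    · have a1 := (tendsto_nhds_of_tendsto_nhdsWithin Real.tendsto_arctan_atBot).comp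
        (hB.atBot_div_const hu₂)
      have a2 := (tendsto_nhds_of_tendsto_nhdsWithin Real.tendsto_arctan_atTop).comp
        (hB.atBot_mul_const_of_neg (inv_lt_zero.2 hu₁))
      have := a1.sub a2
      rwa [show -(Real.pi / 2) - Real.pi / 2 = -Real.pi by ring] at this
  have := htop.sub (hbot.comp tendsto_neg_atTop_atBot)
  rwa [show ((Real.pi : ℝ) : ℂ) - (-Real.pi : ℝ) = 2 * Real.pi by push_cast; ring] at this

/-- Poles of order at least 2 have a single-valued primitive vanishing at infinity, so they
contribute nothing. -/
theorem tendsto_integral_inv_sub_pow {x : ℝ} {p : ℂ} (hx : x ≠ p.re) (k : ℕ) :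
    Tendsto (fun T : ℝ => ∫ y in -T..T, ((x + y * I - p : ℂ) ^ (k + 2))⁻¹) atTop (𝓝 0) := by
  have hne : ∀ y : ℝ, (x + y * I - p : ℂ) ≠ 0 := fun y h => hx (by
    simpa [sub_eq_zero] using congrArg re h)
  set P : ℝ → ℂ := fun y => I / (k + 1) * ((x + y * I - p : ℂ) ^ (k + 1))⁻¹ with hP
  have hk : (k + 1 : ℂ) ≠ 0 := by exact_mod_cast k.succ_ne_zero
  have hd : ∀ y : ℝ, HasDerivAt P (((x + y * I - p : ℂ) ^ (k + 2))⁻¹) y := by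
    intro y
    have h1 : HasDerivAt (fun y : ℝ => (x + y * I - p : ℂ)) I y := by
      simpa using! (((hasDerivAt_id y).ofReal_comp.mul_const I).const_add (x : ℂ)).sub_const p
    refine (((h1.pow (k + 1)).inv (pow_ne_zero _ (hne y))).const_mul (I / (k + 1))).congr_deriv ?_
    have := hne y
    simp only [Nat.add_sub_cancel, Pi.pow_apply]
    push_cast
    generalize (x + y * I - p : ℂ) = w at this
    field_simp
    simp
    ring
  have hint : ∀ T : ℝ, ∫ y in -T..T, ((x + y * I - p : ℂ) ^ (k + 2))⁻¹ = P T - P (-T) := fun T => by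
    refine intervalIntegral.integral_eq_sub_of_hasDerivAt (fun y _ => hd y) ?_
    refine Continuous.intervalIntegrable ?_ _ _
    exact Continuous.inv₀ (by fun_prop) fun y => pow_ne_zero _ (hne y)
  simp_rw [hint]
  have h1 := (tendsto_inv_sub_pow_of_abs_im (f := fun y : ℝ => (x + y * I : ℂ)) p k
    (by simpa using tendsto_abs_atTop_atTop)).const_mul (I / (k + 1))
  have h2 := (tendsto_inv_sub_pow_of_abs_im (f := fun y : ℝ => (x + y * I : ℂ)) p k
    (by simpa using tendsto_abs_atBot_atTop)).const_mul (I / (k + 1))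
  simpa [hP] using h1.sub (h2.comp tendsto_neg_atTop_atBot)

theorem continuous_principalPart_vertical {x : ℝ} {p : ℂ} (hx : x ≠ p.re) (d : ℕ → ℂ) (m : ℕ) :
    Continuous fun y : ℝ => principalPart p d m (x + y * I) := by
  refine continuous_iff_continuousAt.2 fun y => ?_
  refine ContinuousAt.comp (f := fun y : ℝ => (x + y * I : ℂ))
    (differentiableAt_principalPart d m fun h => hx ?_).continuousAt (by fun_prop)
  simpa using congrArg re h

theorem tendsto_integral_principalPart {x₁ x₂ : ℝ} {p : ℂ} (h₁ : x₁ < p.re) (h₂ : p.re < x₂)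
    (d : ℕ → ℂ) (m : ℕ) :
    Tendsto (fun T : ℝ => ∫ y in -T..T,
      (principalPart p d m (x₂ + y * I) - principalPart p d m (x₁ + y * I))) atTop
      (𝓝 (2 * Real.pi * d 0)) := by
  have hcont : ∀ {x : ℝ}, x ≠ p.re → ∀ k : ℕ,
      Continuous fun y : ℝ => ((x + y * I - p : ℂ) ^ (k + 1))⁻¹ := by
    intro x hx k
    refine Continuous.inv₀ (by fun_prop) fun y => pow_ne_zero _ fun h => hx ?_
    simpa [sub_eq_zero] using congrArg re h
  have hterm : ∀ k : ℕ, Tendsto (fun T : ℝ => ∫ y in -T..T,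
      (((x₂ + y * I - p : ℂ) ^ (k + 1))⁻¹ - ((x₁ + y * I - p : ℂ) ^ (k + 1))⁻¹)) atTop
      (𝓝 (if k = 0 then 2 * Real.pi else 0)) := by
    intro k
    rcases k with _ | k
    · simpa using tendsto_integral_inv_sub h₁ h₂
    · have := (tendsto_integral_inv_sub_pow h₂.ne' k).sub (tendsto_integral_inv_sub_pow h₁.ne k)
      simp only [sub_zero] at this
      simp only [Nat.succ_ne_zero, if_false]
      refine this.congr fun T => ?_
      rw [intervalIntegral.integral_sub ((hcont h₂.ne' (k + 1)).intervalIntegrable _ _)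
        ((hcont h₁.ne (k + 1)).intervalIntegrable _ _)]
  have h := tendsto_finsetSum (Finset.range (m + 1)) fun k _ => (hterm k).const_mul (d k)
  simp only [mul_ite, mul_zero, Finset.sum_ite_eq', Finset.mem_range, Nat.succ_pos, if_true] at h
  rw [mul_comm]
  refine h.congr fun T => ?_
  simp_rw [← intervalIntegral.integral_const_mul]
  rw [← intervalIntegral.integral_finsetSum (f := fun k (y : ℝ) => d k *
    (((x₂ + y * I - p : ℂ) ^ (k + 1))⁻¹ - ((x₁ + y * I - p : ℂ) ^ (k + 1))⁻¹))
    fun k _ => Continuous.intervalIntegrable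
    (((hcont h₂.ne' k).sub (hcont h₁.ne k)).const_mul _) _ _]
  simp only [principalPart, mul_sub, Finset.sum_sub_distrib]

/-- Cauchy's theorem on a rectangle of height `2T`; the horizontal sides have fixed length and `f`
tends to 0 uniformly on them. -/
theorem tendsto_integral_sub_of_differentiableAt {x₁ x₂ : ℝ} (hx : x₁ ≤ x₂) {f : ℂ → ℂ}
    (hf : ∀ s : ℂ, x₁ ≤ s.re → s.re ≤ x₂ → DifferentiableAt ℂ f s)
    (hlim : Tendsto f (stripInfty x₁ x₂) (𝓝 0)) :
    Tendsto (fun T : ℝ => ∫ y in -T..T, (f (x₂ + y * I) - f (x₁ + y * I))) atTop (𝓝 0) := by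
  have hcont : ∀ x : ℝ, x₁ ≤ x → x ≤ x₂ → Continuous fun y : ℝ => f (x + y * I) := by
    intro x h1 h2
    refine continuous_iff_continuousAt.2 fun y => ?_
    exact ContinuousAt.comp (f := fun y : ℝ => (x + y * I : ℂ))
      (hf _ (by simpa using h1) (by simpa using h2)).continuousAt (by fun_prop)
  have hrect : ∀ T : ℝ, ∫ y in -T..T, (f (x₂ + y * I) - f (x₁ + y * I)) =
      I * ((∫ x in x₁..x₂, f (x + (-T : ℝ) * I)) - ∫ x in x₁..x₂, f (x + T * I)) := by
    intro T
    have h := integral_boundary_rect_eq_zero_of_differentiableOn f (x₁ + (-T : ℝ) * I)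
      (x₂ + T * I) fun s hs => by
        have hs1 := hs.1
        simp [uIcc_of_le hx] at hs1
        exact (hf s hs1.1 hs1.2).differentiableWithinAt
    rw [intervalIntegral.integral_sub ((hcont x₂ hx le_rfl).intervalIntegrable _ _)
      ((hcont x₁ le_rfl hx).intervalIntegrable _ _)]
    simp only [add_re, ofReal_re, mul_re, I_re, mul_zero, ofReal_im, I_im, mul_one, sub_self,
      add_zero, add_im, mul_im, zero_add, smul_eq_mul] at h
    linear_combination (-I) * h + (∫ y in -T..T, f (x₂ + y * I)) * I_sq -
      (∫ y in -T..T, f (x₁ + y * I)) * I_sq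
  simp_rw [hrect]
  rw [Metric.tendsto_atTop]
  intro ε hε
  -- The `+ 1` covers a strip of width zero and makes the final inequality strict.
  set η := ε / (2 * (x₂ - x₁) + 1) with hη
  have hη0 : 0 < η := div_pos hε (by linarith)
  have hev : ∀ᶠ s in stripInfty x₁ x₂, ‖f s‖ < η := by
    simpa using (Metric.tendsto_nhds.1 hlim) η hη0
  rw [stripInfty, eventually_inf_principal, eventually_comap] at hev
  obtain ⟨T₀, hT₀⟩ := eventually_atTop.1 hev
  have hb : ∀ T : ℝ, T₀ ≤ |T| → ‖∫ x in x₁..x₂, f (x + T * I)‖ ≤ η * (x₂ - x₁) := by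
    intro T hT
    have := intervalIntegral.norm_integral_le_of_norm_le_const (C := η)
      (f := fun x : ℝ => f (x + T * I)) (a := x₁) (b := x₂) fun x hx' => by
        rw [uIoc_of_le hx] at hx'
        exact (hT₀ |T| hT (x + T * I) (by simp) (by simpa using ⟨hx'.1.le, hx'.2⟩)).le
    rwa [abs_of_nonneg (by linarith)] at this
  refine ⟨T₀, fun T hT => ?_⟩
  have hT' : T₀ ≤ |T| := (show T₀ ≤ T from hT).trans (le_abs_self T)
  rw [dist_zero_right, norm_mul, norm_I, one_mul]
  calc _ ≤ η * (x₂ - x₁) + η * (x₂ - x₁) :=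
        (norm_sub_le _ _).trans (add_le_add (hb _ (by rwa [abs_neg])) (hb _ hT'))
    _ < η * (2 * (x₂ - x₁) + 1) := by linarith
    _ = ε := by
      rw [hη]
      have : 2 * (x₂ - x₁) + 1 ≠ 0 := by linarith
      field_simp

/-- The residue theorem for a vertical strip. -/
theorem tendsto_integral_sub_residues {x₁ x₂ : ℝ} (hx : x₁ ≤ x₂) (S : Finset ℂ)
    (hS : ∀ p ∈ S, x₁ < p.re ∧ p.re < x₂) (d : ℂ → ℕ → ℂ) (m : ℕ) {f : ℂ → ℂ}
    (hf : ∀ s : ℂ, x₁ ≤ s.re → s.re ≤ x₂ → s ∉ S → DifferentiableAt ℂ f s)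
    (hd : ∀ p ∈ S, (fun s => f s - principalPart p (d p) m s) =O[𝓝[≠] p] fun _ => (1 : ℂ))
    (hlim : Tendsto f (stripInfty x₁ x₂) (𝓝 0)) :
    Tendsto (fun T : ℝ => ∫ y in -T..T, (f (x₂ + y * I) - f (x₁ + y * I))) atTop
      (𝓝 (2 * Real.pi * ∑ p ∈ S, d p 0)) := by
  induction S using Finset.induction_on generalizing f with
  | empty =>
    simpa using tendsto_integral_sub_of_differentiableAt hx
      (fun s h1 h2 => hf s h1 h2 (Finset.notMem_empty s)) hlim
  | insert p S hp ih =>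
    obtain ⟨hp1, hp2⟩ := hS p (Finset.mem_insert_self _ _)
    set g : ℂ → ℂ := fun s => f s - principalPart p (d p) m s with hg
    -- Induction on the number of poles: removing the principal part at `p` leaves a function
    -- bounded near `p`, and `g'` fills in its removable singularity.
    set g' : ℂ → ℂ := Function.update g p (limUnder (𝓝[≠] p) g) with hg'
    have hne : ∀ {s : ℂ}, s ≠ p → g' s = g s := fun h => Function.update_of_ne h _ _
    have hnear : ∀ {s : ℂ}, s ≠ p → g' =ᶠ[𝓝 s] g := by
      intro s hs
      filter_upwards [isOpen_ne.mem_nhds hs] with w hw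
      exact hne hw
    have hgd : ∀ s : ℂ, x₁ ≤ s.re → s.re ≤ x₂ → s ∉ S → s ≠ p → DifferentiableAt ℂ g s := by
      intro s h1 h2 h3 h4
      exact (hf s h1 h2 (by simp [h3, h4])).sub (differentiableAt_principalPart _ _ h4)
    have hU : {s : ℂ | x₁ < s.re ∧ s.re < x₂} \ (S : Set ℂ) ∈ 𝓝 p := by
      refine IsOpen.mem_nhds ?_ ⟨⟨hp1, hp2⟩, hp⟩
      exact ((isOpen_lt continuous_const continuous_re).inter
        (isOpen_lt continuous_re continuous_const)).sdiff S.finite_toSet.isClosed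
    have hgp : DifferentiableAt ℂ g' p := by
      refine (differentiableOn_update_limUnder_of_isLittleO hU
        (fun s hs => (hgd s hs.1.1.1.le hs.1.1.2.le hs.1.2 hs.2).differentiableWithinAt)
        ?_).differentiableAt hU
      have h1 : (fun s => g s - g p) =O[𝓝[≠] p] fun _ => (1 : ℂ) :=
        (hd p (Finset.mem_insert_self _ _)).sub (isBigO_const_const _ one_ne_zero _)
      -- Riemann's criterion: a bounded function is `o(1/(s - p))` at `p`.
      refine h1.trans_isLittleO ((isLittleO_const_left).2 (Or.inr ?_))
      have : Tendsto (fun s => s - p) (𝓝[≠] p) (𝓝[≠] 0) := by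
        refine tendsto_nhdsWithin_iff.2 ⟨?_, ?_⟩
        · have : Tendsto (fun s => s - p) (𝓝 p) (𝓝 (p - p)) := by
            exact (continuous_sub_right p).tendsto p
          rw [sub_self] at this
          exact this.mono_left nhdsWithin_le_nhds
        · filter_upwards [self_mem_nhdsWithin] with s hs
          exact sub_ne_zero.2 hs
      exact tendsto_norm_atTop_iff_cobounded.2 (tendsto_inv₀_nhdsNE_zero.comp this)
    have key := ih (fun q hq => hS q (Finset.mem_insert_of_mem hq)) (f := g') ?_ ?_ ?_
    · have hsum := key.add (tendsto_integral_principalPart hp1 hp2 (d p) m)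
      rw [← mul_add] at hsum
      rw [Finset.sum_insert hp, add_comm]
      have hxp : ∀ {x : ℝ} (y : ℝ), x ≠ p.re → (x + y * I : ℂ) ≠ p := by
        intro x y hx h
        exact hx (by simpa using congrArg re h)
      have hcg : ∀ x : ℝ, x₁ ≤ x → x ≤ x₂ → (∀ q ∈ insert p S, x ≠ q.re) →
          Continuous fun y : ℝ => g' (x + y * I) := by
        intro x h1 h2 h3
        refine continuous_iff_continuousAt.2 fun y => ?_
        have hn : (x + y * I : ℂ) ∉ insert p S := fun hmem => h3 _ hmem (by simp)
        rw [Finset.mem_insert, not_or] at hn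
        have h4 : ContinuousAt g' (x + y * I) :=
          ((hgd _ (by simpa using h1) (by simpa using h2) hn.2 hn.1).congr_of_eventuallyEq
          (hnear hn.1)).continuousAt
        exact ContinuousAt.comp (f := fun y : ℝ => (x + y * I : ℂ)) h4 (by fun_prop)
      refine hsum.congr fun T => ?_
      rw [← intervalIntegral.integral_add
        (f := fun y : ℝ => g' (x₂ + y * I) - g' (x₁ + y * I))
        (g := fun y : ℝ => principalPart p (d p) m (x₂ + y * I) -
          principalPart p (d p) m (x₁ + y * I))
        (((hcg x₂ hx le_rfl fun q hq => (hS q hq).2.ne').sub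
          (hcg x₁ le_rfl hx fun q hq => (hS q hq).1.ne)).intervalIntegrable _ _)
        (((continuous_principalPart_vertical hp2.ne' _ _).sub
          (continuous_principalPart_vertical hp1.ne _ _)).intervalIntegrable _ _)]
      refine intervalIntegral.integral_congr fun y _ => ?_
      simp only [hne (hxp y hp2.ne'), hne (hxp y hp1.ne), hg]
      ring
    · intro s h1 h2 h3
      by_cases h4 : s = p
      · rwa [h4]
      · exact (hgd s h1 h2 h3 h4).congr_of_eventuallyEq (hnear h4)
    · intro q hq
      have hqp : q ≠ p := fun h => hp (h ▸ hq)
      have h1 := hd q (Finset.mem_insert_of_mem hq)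
      have h2 : principalPart p (d p) m =O[𝓝[≠] q] fun _ => (1 : ℂ) :=
        ((differentiableAt_principalPart (d p) m hqp).continuousAt.tendsto.mono_left
          nhdsWithin_le_nhds).isBigO_one ℂ
      refine (h1.sub h2).congr' ?_ EventuallyEq.rfl
      filter_upwards [(hnear hqp).filter_mono nhdsWithin_le_nhds] with s hs
      rw [hs]
      simp only [hg]
      ring
    · have h1 := hlim.sub (tendsto_principalPart_stripInfty p (d p) m x₁ x₂)
      rw [sub_zero] at h1
      refine h1.congr' ?_
      have : Tendsto (fun s : ℂ => |s.im|) (stripInfty x₁ x₂) atTop :=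
        tendsto_comap.mono_left inf_le_left
      filter_upwards [this.eventually_gt_atTop |p.im|] with s hs
      exact (hne fun h => hs.ne (by rw [h])).symm

end ResidueTheorem

/-! ### Residues of the integrand through power series. -/

section TaylorSeries

open Complex Set

/-- The Taylor series at `0` of a function. -/
noncomputable def taylorSeriesZero (f : ℂ → ℂ) : PowerSeries ℂ :=
  PowerSeries.mk fun k => iteratedDeriv k f 0 / (k.factorial : ℂ)

theorem coeff_taylorSeriesZero_regularize (f : ℂ → ℂ) (k : ℕ) :
    PowerSeries.coeff k (taylorSeriesZero (regularize f)) = taylorCoeff f k :=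
  PowerSeries.coeff_mk _ _

/-- Leibniz's rule; the binomial coefficients are absorbed by the factorials. -/
theorem taylorSeriesZero_mul {f g : ℂ → ℂ} (hf : AnalyticAt ℂ f 0) (hg : AnalyticAt ℂ g 0) :
    taylorSeriesZero (f * g) = taylorSeriesZero f * taylorSeriesZero g := by
  ext n
  rw [PowerSeries.coeff_mul]
  simp only [taylorSeriesZero, PowerSeries.coeff_mk]
  rw [iteratedDeriv_mul hf.contDiffAt hg.contDiffAt,
    Finset.Nat.sum_antidiagonal_eq_sum_range_succ_mk, Finset.sum_div]
  refine Finset.sum_congr rfl fun i hi => ?_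
  have hin : i ≤ n := Nat.lt_succ_iff.1 (Finset.mem_range.1 hi)
  rw [Nat.cast_choose ℂ hin]
  have h1 : (n.factorial : ℂ) ≠ 0 := by exact_mod_cast n.factorial_ne_zero
  field_simp

theorem taylorSeriesZero_prod {ι : Type*} (S : Finset ι) {f : ι → ℂ → ℂ}
    (hf : ∀ i ∈ S, AnalyticAt ℂ (f i) 0) :
    taylorSeriesZero (∏ i ∈ S, f i) = ∏ i ∈ S, taylorSeriesZero (f i) := by
  classical
  induction S using Finset.induction_on with
  | empty =>
    ext n
    rw [Finset.prod_empty, Finset.prod_empty, taylorSeriesZero, PowerSeries.coeff_mk,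
      PowerSeries.coeff_one, show (1 : ℂ → ℂ) = fun _ => 1 from rfl, iteratedDeriv_const]
    split_ifs with h <;> simp [h]
  | insert i S hi ih =>
    have hS : ∀ j ∈ S, AnalyticAt ℂ (f j) 0 := fun j hj => hf j (Finset.mem_insert_of_mem hj)
    rw [Finset.prod_insert hi, Finset.prod_insert hi,
      taylorSeriesZero_mul (hf i (Finset.mem_insert_self _ _)) (Finset.analyticAt_prod _ hS),
      ih hS]

theorem coeff_taylorSeriesZero_exp (L : ℂ) (k : ℕ) :
    PowerSeries.coeff k (taylorSeriesZero fun z => exp (L * z)) = L ^ k / (k.factorial : ℂ) := by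
  rw [taylorSeriesZero, PowerSeries.coeff_mk, iteratedDeriv_cexp_const_mul]
  simp

theorem coeff_prod_eq_sum_piFinset {R ι : Type*} [CommSemiring R] [Fintype ι] [DecidableEq ι]
    (ψ : ι → PowerSeries R) {q n : ℕ} (hq : q ≤ n) :
    PowerSeries.coeff q (∏ j, ψ j) =
      ∑ k ∈ Fintype.piFinset (fun _ : ι => Finset.range (n + 1)),
        if ∑ j, k j = q then ∏ j, PowerSeries.coeff (k j) (ψ j) else 0 := by
  rw [PowerSeries.coeff_prod, ← Finset.sum_filter]
  refine Finset.sum_nbij' (fun l => ⇑l) (fun k => Finsupp.equivFunOnFinite.symm k) ?_ ?_ ?_ ?_ ?_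
  · intro l hl
    simp only [Finset.mem_finsuppAntidiag, Finset.subset_univ, and_true] at hl
    simp only [Finset.mem_filter, Fintype.mem_piFinset, Finset.mem_range]
    refine ⟨fun j => ?_, hl⟩
    have := Finset.single_le_sum (f := fun j => l j) (fun _ _ => Nat.zero_le _) (Finset.mem_univ j)
    lia
  · intro k hk
    simpa using (Finset.mem_filter.1 hk).2
  · intro l _
    ext
    simp
  · intro k _
    rfl
  · intro l _
    rfl

/-- The indices are cut off at a common `n ≥ m` to match the form of `expansionCoeff`; those above
`m` cannot meet the constraint. -/
theorem coeff_mul_prod_eq_sum {R ι : Type*} [CommSemiring R] [Fintype ι] [DecidableEq ι]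
    (φ : PowerSeries R) (ψ : ι → PowerSeries R) {m n : ℕ} (hm : m ≤ n) :
    PowerSeries.coeff m (φ * ∏ j, ψ j) = ∑ p ∈ Finset.range (n + 1),
      ∑ k ∈ Fintype.piFinset (fun _ : ι => Finset.range (n + 1)),
        if p + ∑ j, k j = m then
          PowerSeries.coeff p φ * ∏ j, PowerSeries.coeff (k j) (ψ j) else 0 := by
  rw [PowerSeries.coeff_mul, Finset.Nat.sum_antidiagonal_eq_sum_range_succ_mk]
  refine Finset.sum_subset_zero_on_sdiff (Finset.range_mono (by lia)) ?_ ?_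
  · intro p hp
    have hp' : ¬ p < m.succ := by simpa using (Finset.mem_sdiff.1 hp).2
    exact Finset.sum_eq_zero fun k _ => if_neg (by lia)
  · intro p hp
    have hp' := Finset.mem_range.1 hp
    rw [coeff_prod_eq_sum_piFinset ψ (show m - p ≤ n by lia), Finset.mul_sum]
    refine Finset.sum_congr rfl fun k _ => ?_
    rw [mul_ite, mul_zero]
    exact if_congr (by lia) rfl rfl

/-- The analytic function `z^{ℓ+1} Γ(-a+z) ∏ ζ(-a+1-α_j+z)`. -/
noncomputable def regularizedMellin {ℓ : ℕ} (α : Fin ℓ → ℂ) (a : ℂ) : ℂ → ℂ :=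
  (regularize fun z => z * Gamma (-a + z)) *
    ∏ j, regularize fun z => z * riemannZeta (-a + 1 - α j + z)

theorem analyticAt_regularizedMellin {ℓ : ℕ} (α : Fin ℓ → ℂ) (a : ℂ) :
    AnalyticAt ℂ (regularizedMellin α a) 0 :=
  (analyticAt_regularize_Gamma _).mul
    (Finset.analyticAt_prod _ fun _ _ => analyticAt_regularize_zeta _)

theorem regularizedMellin_eq {ℓ : ℕ} (α : Fin ℓ → ℂ) (a : ℂ) {z : ℂ} (hz : z ≠ 0) :
    regularizedMellin α a z = z ^ (ℓ + 1) * ZMellin α (-a + z) := by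
  simp only [regularizedMellin, ZMellin, Pi.mul_apply, Finset.prod_apply, regularize,
    Function.update_of_ne hz, Finset.prod_mul_distrib, Finset.prod_const, Finset.card_univ,
    Fintype.card_fin, pow_succ]
  simp_rw [show ∀ j, -a + 1 - α j + z = -a + z + 1 - α j by intro j; ring]
  ring

theorem expansionCoeff_eq {ℓ : ℕ} (α : Fin ℓ → ℂ) (a : ℂ) {b : ℕ} (hb : b ≤ ℓ) :
    expansionCoeff α a b = 1 / (b.factorial : ℂ) *
      PowerSeries.coeff (ℓ - b) (taylorSeriesZero (regularizedMellin α a)) := by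
  rw [regularizedMellin, taylorSeriesZero_mul (analyticAt_regularize_Gamma _)
    (Finset.analyticAt_prod _ fun _ _ => analyticAt_regularize_zeta _),
    taylorSeriesZero_prod _ fun _ _ => analyticAt_regularize_zeta _,
    coeff_mul_prod_eq_sum _ _ (Nat.sub_le ℓ b), expansionCoeff]
  simp only [coeff_taylorSeriesZero_regularize]
  congr 1
  refine Finset.sum_congr rfl fun p _ => Finset.sum_congr rfl fun k _ => ?_
  exact if_congr (by lia) rfl rfl

/-- The coefficients of the principal part of `t^{-s}` times the Mellin transform at `s = -a`. -/
noncomputable def principalCoeff {ℓ : ℕ} (α : Fin ℓ → ℂ) (t : ℝ) (a : ℂ) (k : ℕ) : ℂ :=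
  (t : ℂ) ^ a * PowerSeries.coeff (ℓ - k) (taylorSeriesZero
    ((fun z => exp (((-Real.log t : ℝ) : ℂ) * z)) * regularizedMellin α a))

/-- The `b`-th coefficient of the exponential series is `(-ln t)^b / b!`, and its partner of index
`ℓ - b` is the rest of `expansionCoeff`. -/
theorem principalCoeff_zero {ℓ : ℕ} (α : Fin ℓ → ℂ) (t : ℝ) (a : ℂ) :
    principalCoeff α t a 0 = ∑ b ∈ Finset.range (ℓ + 1),
      expansionCoeff α a b * (t : ℂ) ^ a * ((-Real.log t : ℝ) : ℂ) ^ b := by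
  rw [principalCoeff, taylorSeriesZero_mul (by fun_prop) (analyticAt_regularizedMellin α a),
    PowerSeries.coeff_mul, Nat.sub_zero, Finset.Nat.sum_antidiagonal_eq_sum_range_succ_mk,
    Finset.mul_sum]
  refine Finset.sum_congr rfl fun b hb => ?_
  rw [expansionCoeff_eq α a (Nat.lt_succ_iff.1 (Finset.mem_range.1 hb)),
    coeff_taylorSeriesZero_exp]
  ring

/-- Divide the Taylor expansion of the regularized integrand to order `ℓ + 1` by `z^{ℓ+1}`: the
polynomial becomes the principal part and the remainder stays analytic. The same order `ℓ + 1`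
serves every exponent, as a pole of lower order merely has vanishing coefficients. -/
theorem isBigO_sub_principalPart {ℓ : ℕ} (α : Fin ℓ → ℂ) {t : ℝ} (ht : 0 < t) (a : ℂ) :
    (fun s => (t : ℂ) ^ (-s) * ZMellin α s - principalPart (-a) (principalCoeff α t a) ℓ s)
      =O[𝓝[≠] (-a)] fun _ => (1 : ℂ) := by
  set H : ℂ → ℂ := (fun z => exp (((-Real.log t : ℝ) : ℂ) * z)) * regularizedMellin α a with hH
  have hHa : AnalyticAt ℂ H 0 :=
    AnalyticAt.mul (by fun_prop) (analyticAt_regularizedMellin α a)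
  obtain ⟨R, hR, hRH⟩ := hHa.exists_eq_sum_add_pow_mul (ℓ + 1)
  have key : ∀ s : ℂ, s ≠ -a → (t : ℂ) ^ a * R (s - -a) =
      (t : ℂ) ^ (-s) * ZMellin α s - principalPart (-a) (principalCoeff α t a) ℓ s := by
    intro s hs
    set z := s - -a with hz
    have hz0 : z ≠ 0 := sub_ne_zero.2 hs
    have hsz : s = -a + z := by rw [hz]; ring
    have htc : (t : ℂ) ≠ 0 := by exact_mod_cast ht.ne'
    have h1 : (t : ℂ) ^ (-s) * ZMellin α s = (t : ℂ) ^ a * (H z * (z ^ (ℓ + 1))⁻¹) := by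
      rw [hH, Pi.mul_apply, regularizedMellin_eq α a hz0, hsz,
        show -(-a + z) = a + -z by ring, cpow_add _ _ htc, cpow_def_of_ne_zero htc (-z),
        ← ofReal_log ht.le, show (Real.log t : ℂ) * -z = ((-Real.log t : ℝ) : ℂ) * z by
          push_cast; ring]
      have := pow_ne_zero (ℓ + 1) hz0
      field_simp
    have h2 : principalPart (-a) (principalCoeff α t a) ℓ s = (t : ℂ) ^ a *
        ((∑ i ∈ Finset.range (ℓ + 1), (z ^ i / (i.factorial : ℂ)) • iteratedDeriv i H 0) *
          (z ^ (ℓ + 1))⁻¹) := by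
      -- Taylor index `i` corresponds to the pole term of order `ℓ + 1 - i`, hence the reflection.
      rw [principalPart, ← Finset.sum_range_reflect, Finset.sum_mul, Finset.mul_sum]
      refine Finset.sum_congr rfl fun i hi => ?_
      have hi' : i ≤ ℓ := Nat.lt_succ_iff.1 (Finset.mem_range.1 hi)
      rw [principalCoeff, ← hH, taylorSeriesZero, PowerSeries.coeff_mk, ← hz,
        show ℓ - (ℓ + 1 - 1 - i) = i by lia, show ℓ + 1 - 1 - i + 1 = ℓ + 1 - i by lia,
        smul_eq_mul]
      have h3 : z ^ (ℓ + 1) = z ^ (ℓ + 1 - i) * z ^ i := by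
        rw [← pow_add]
        congr 1
        lia
      have := pow_ne_zero i hz0
      have := pow_ne_zero (ℓ + 1 - i) hz0
      rw [h3]
      field_simp
    rw [h1, h2, hRH z, smul_eq_mul]
    have := pow_ne_zero (ℓ + 1) hz0
    field_simp
    ring
  have hcont : ContinuousAt (fun s : ℂ => (t : ℂ) ^ a * R (s - -a)) (-a) := by
    refine continuousAt_const.mul (ContinuousAt.comp (f := fun s : ℂ => s - -a) ?_ (by fun_prop))
    simpa using hR.continuousAt
  refine ((hcont.tendsto.mono_left nhdsWithin_le_nhds).isBigO_one ℂ).congr' ?_ EventuallyEq.rfl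
  filter_upwards [self_mem_nhdsWithin] with s hs
  exact key s hs

end TaylorSeries

/-! ### Shifting the contour. -/

section Expansion

open Complex MeasureTheory Set

theorem differentiableAt_ZMellin {ℓ : ℕ} (α : Fin ℓ → ℂ) {s : ℂ} (hs : -s ∉ exponents α) :
    DifferentiableAt ℂ (ZMellin α) s := by
  simp only [exponents, mem_union, mem_range, not_or, not_exists] at hs
  unfold ZMellin
  refine DifferentiableAt.mul (differentiableAt_Gamma _ fun m hm => hs.1 m (by simp [hm])) ?_
  refine DifferentiableAt.fun_finsetProd fun j _ => ?_
  have h1 : s + 1 - α j ≠ 1 := fun h => hs.2 j (by linear_combination h)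
  exact (differentiableAt_riemannZeta h1).comp s (f := fun s => s + 1 - α j) (by fun_prop)

theorem differentiableAt_cpow_mul_ZMellin {ℓ : ℕ} (α : Fin ℓ → ℂ) {t : ℝ} (ht : 0 < t) {s : ℂ}
    (hs : -s ∉ exponents α) :
    DifferentiableAt ℂ (fun s => (t : ℂ) ^ (-s) * ZMellin α s) s := by
  refine DifferentiableAt.mul ?_ (differentiableAt_ZMellin α hs)
  exact DifferentiableAt.const_cpow (by fun_prop) (Or.inl (by exact_mod_cast ht.ne'))

theorem tendsto_stripInfty_of_stripExpBound {f : ℂ → ℂ} {x₁ x₂ r : ℝ} (hr : r < 0)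
    (hf : StripExpBound f x₁ x₂ r) : Tendsto f (stripInfty x₁ x₂) (𝓝 0) := by
  obtain ⟨C, T, h⟩ := hf
  have him : Tendsto (fun s : ℂ => |s.im|) (stripInfty x₁ x₂) atTop :=
    tendsto_comap.mono_left inf_le_left
  have hlim : Tendsto (fun s : ℂ => C * Real.exp (r * |s.im|)) (stripInfty x₁ x₂) (𝓝 0) := by
    simpa using (Real.tendsto_exp_atBot.comp (him.const_mul_atTop_of_neg hr)).const_mul C
  refine squeeze_zero_norm' ?_ hlim
  have hstrip : ∀ᶠ s in stripInfty x₁ x₂, x₁ ≤ s.re ∧ s.re ≤ x₂ :=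
    Filter.mem_inf_of_right (mem_principal_self _)
  filter_upwards [him.eventually_ge_atTop T, hstrip] with s h1 h2
  exact h s h2.1 h2.2 h1

theorem stripExpBound_cpow_mul_ZMellin {ℓ : ℕ} (α : Fin ℓ → ℂ) {t : ℝ} (ht : 0 < t) (A B : ℝ) :
    StripExpBound (fun s => (t : ℂ) ^ (-s) * ZMellin α s) A B (-1 / 2) := by
  simpa using (stripExpBound_const_cpow A B ht).mul (stripExpBound_ZMellin α A B)

theorem integrable_ZMellin_vertical {ℓ : ℕ} (α : Fin ℓ → ℂ) {x : ℝ}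
    (hx : ∀ a ∈ exponents α, a.re ≠ -x) : Integrable fun y : ℝ => ZMellin α (x + y * I) := by
  refine integrable_comp_vertical_of_stripExpBound (r := -1 / 2) (by norm_num)
    (stripExpBound_ZMellin α x x) (continuous_iff_continuousAt.2 fun y => ?_)
  have h : ContinuousAt (ZMellin α) (x + y * I) :=
    (differentiableAt_ZMellin α fun h => hx _ h (by simp)).continuousAt
  exact ContinuousAt.comp (f := fun y : ℝ => (x + y * I : ℂ)) h (by fun_prop)

theorem norm_cpow_mul_ZMellin_vertical {ℓ : ℕ} (α : Fin ℓ → ℂ) {t : ℝ} (ht : 0 < t) (x y : ℝ) :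
    ‖(t : ℂ) ^ (-(x + y * I : ℂ)) * ZMellin α (x + y * I)‖ =
      t ^ (-x) * ‖ZMellin α (x + y * I)‖ := by
  rw [norm_mul, norm_cpow_eq_rpow_re_of_pos ht]
  simp

theorem integrable_cpow_mul_ZMellin_vertical {ℓ : ℕ} (α : Fin ℓ → ℂ) {t : ℝ} (ht : 0 < t) {x : ℝ}
    (hx : ∀ a ∈ exponents α, a.re ≠ -x) :
    Integrable fun y : ℝ => (t : ℂ) ^ (-(x + y * I : ℂ)) * ZMellin α (x + y * I) := by
  have h := integrable_ZMellin_vertical α hx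
  refine (h.norm.const_mul (t ^ (-x))).mono' (AEStronglyMeasurable.mul ?_ h.aestronglyMeasurable)
    (Eventually.of_forall fun y => (norm_cpow_mul_ZMellin_vertical α ht x y).le)
  refine Continuous.aestronglyMeasurable ?_
  exact Continuous.const_cpow (by fun_prop) (Or.inl (by exact_mod_cast ht.ne'))

theorem neg_lt_re_of_mem_exponents {ℓ : ℕ} {α : Fin ℓ → ℂ} {c : ℝ} (hc : 0 < c)
    (hα : ∀ j, (α j).re < c) {a : ℂ} (ha : a ∈ exponents α) : -c < a.re := by
  rcases ha with ⟨n, rfl⟩ | ⟨j, rfl⟩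
  · have : (0 : ℝ) ≤ n := n.cast_nonneg
    simp
    linarith
  · simpa using hα j

/-- Only finitely many exponents have real part at most `N + 1`, so some room is left just above
`N`. -/
theorem exists_lt_forall_re_le_of_le {ℓ : ℕ} (α : Fin ℓ → ℂ) (N : ℝ) :
    ∃ M, N < M ∧ ∀ a ∈ exponents α, a.re ≤ M → a.re ≤ N := by
  have h1 : ∀ᶠ M in 𝓝[>] N, ∀ a ∈ {a ∈ exponents α | a.re ≤ N + 1}, N < a.re → M < a.re := by
    rw [(exponents_finite α (N + 1)).eventually_all]
    intro a _
    by_cases h : N < a.re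
    · filter_upwards [Ioo_mem_nhdsGT h] with M hM _ using hM.2
    · exact Eventually.of_forall fun M h' => absurd h' h
  obtain ⟨M, h2, h4⟩ := (h1.and (Ioo_mem_nhdsGT (lt_add_one N))).exists
  refine ⟨M, h4.1, fun a ha haM => ?_⟩
  by_contra hN
  exact (h2 a ⟨ha, haM.trans h4.2.le⟩ (not_le.1 hN)).not_ge haM

theorem ZSum_sub_partialExpansion {ℓ : ℕ} (α : Fin ℓ → ℂ) {N M : ℝ} (hN : 0 ≤ N) (hM : N < M)
    (hgap : ∀ a ∈ exponents α, a.re ≤ M → a.re ≤ N) {t : ℝ} (ht : 0 < t) :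
    2 * Real.pi * (ZSum α t - partialExpansion α N t) =
      ∫ y : ℝ, (t : ℂ) ^ (-(((-M : ℝ) : ℂ) + y * I)) * ZMellin α (((-M : ℝ) : ℂ) + y * I) := by
  obtain ⟨c, hc0, hc⟩ : ∃ c : ℝ, 0 < c ∧ ∀ j, (α j).re < c := by
    obtain ⟨B, hB⟩ := (finite_range fun j => (α j).re).bddAbove
    exact ⟨max B 0 + 1, by positivity, fun j => (hB ⟨j, rfl⟩).trans_lt
      ((le_max_left B 0).trans_lt (lt_add_one _))⟩
  set E := (exponents_finite α N).toFinset with hE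
  have hmem : ∀ {a : ℂ}, a ∈ E ↔ a ∈ exponents α ∧ a.re ≤ N := by simp [hE]
  have hcint := integrable_cpow_mul_ZMellin_vertical α ht (x := c) fun a ha =>
    (neg_lt_re_of_mem_exponents hc0 hc ha).ne'
  have hMint := integrable_cpow_mul_ZMellin_vertical α ht (x := -M) fun a ha h => by
    rw [neg_neg] at h
    exact hM.not_ge (h ▸ hgap a ha h.le)
  -- The poles are the negatives of the exponents, so the data at `p` belong to the exponent `-p`.
  -- The gap hypothesis keeps the line `Re s = -M` free of poles.
  have hres := tendsto_integral_sub_residues (x₁ := -M) (x₂ := c) (by linarith)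
    (E.map (Equiv.neg ℂ).toEmbedding) ?_ (fun p => principalCoeff α t (-p)) ℓ
    (f := fun s => (t : ℂ) ^ (-s) * ZMellin α s) ?_ ?_
    (tendsto_stripInfty_of_stripExpBound (by norm_num) (stripExpBound_cpow_mul_ZMellin α ht _ _))
  · have hlim := (intervalIntegral_tendsto_integral hcint tendsto_neg_atTop_atBot tendsto_id).sub
      (intervalIntegral_tendsto_integral hMint tendsto_neg_atTop_atBot tendsto_id)
    have heq := tendsto_nhds_unique (hlim.congr fun T => by
      rw [id, ← intervalIntegral.integral_sub hcint.intervalIntegrable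
        hMint.intervalIntegrable]) hres
    have hZ : ∫ y : ℝ, (t : ℂ) ^ (-(c + y * I : ℂ)) * ZMellin α (c + y * I) =
        2 * Real.pi * ZSum α t := by
      rw [ZSum, ← tsum_mul_left, (hasSum_ZTerm α hc0 hc ht).tsum_eq]
    have hP : ∑ p ∈ E.map (Equiv.neg ℂ).toEmbedding, principalCoeff α t (-p) 0 =
        partialExpansion α N t := by
      simp [partialExpansion, principalCoeff_zero, hE]
    rw [hZ, hP] at heq
    linear_combination heq
  · intro p hp
    obtain ⟨a, ha, rfl⟩ := Finset.mem_map.1 hp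
    have h1 := (hmem.1 ha).2
    have h2 := neg_lt_re_of_mem_exponents hc0 hc (hmem.1 ha).1
    constructor <;> simp <;> linarith
  · intro s h1 h2 h3
    refine differentiableAt_cpow_mul_ZMellin α ht fun h => h3 ?_
    refine Finset.mem_map.2 ⟨-s, hmem.2 ⟨h, hgap _ h ?_⟩, by simp⟩
    rw [neg_re]
    linarith
  · intro p _
    simpa using isBigO_sub_principalPart α ht (-p)

end Expansion

/-! ### Convergence and the error estimate. -/

theorem theorem4 (ℓ : ℕ) (α : Fin ℓ → ℂ) :
    (∀ t : ℝ, 0 < t → Summable (ZTerm α t)) ∧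
      ∀ N : ℝ, 0 ≤ N →
        (fun t : ℝ => ZSum α t - partialExpansion α N t) =o[𝓝[>] (0 : ℝ)] (fun t : ℝ => t ^ N) := by
  have h2π : (2 * Real.pi : ℂ) ≠ 0 := by exact_mod_cast Real.two_pi_pos.ne'
  refine ⟨fun t ht => ?_, fun N hN => ?_⟩
  · obtain ⟨B, hB⟩ := (Set.finite_range fun j => (α j).re).bddAbove
    have h := hasSum_ZTerm α (c := max B 0 + 1) (by positivity) (fun j => (hB ⟨j, rfl⟩).trans_lt
      ((le_max_left B 0).trans_lt (lt_add_one _))) ht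
    exact (summable_mul_left_iff h2π).1 h.summable
  · obtain ⟨M, hM, hgap⟩ := exists_lt_forall_re_le_of_le α N
    -- On `Re s = -M` the factor `t^{-s}` has modulus exactly `t^M`, and what remains of the
    -- integral does not depend on `t`.
    have hO : (fun t : ℝ => ZSum α t - partialExpansion α N t) =O[𝓝[>] (0 : ℝ)]
        (fun t : ℝ => t ^ M) := by
      refine IsBigO.of_bound
        ((∫ y : ℝ, ‖ZMellin α (((-M : ℝ) : ℂ) + y * Complex.I)‖) / (2 * Real.pi)) ?_
      filter_upwards [self_mem_nhdsWithin] with t ht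
      have ht' : 0 < t := ht
      have h := congrArg norm (ZSum_sub_partialExpansion α hN hM hgap ht)
      rw [norm_mul, show ‖(2 * Real.pi : ℂ)‖ = 2 * Real.pi by
        simp [abs_of_pos Real.pi_pos]] at h
      rw [Real.norm_of_nonneg (by positivity), div_mul_eq_mul_div, le_div_iff₀ Real.two_pi_pos,
        mul_comm, h, mul_comm]
      refine (MeasureTheory.norm_integral_le_integral_norm _).trans (le_of_eq ?_)
      simp_rw [norm_cpow_mul_ZMellin_vertical α ht', MeasureTheory.integral_const_mul, neg_neg]
    refine hO.trans_isLittleO ?_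
    have hlim : Tendsto (fun t : ℝ => t ^ (M - N)) (𝓝[>] 0) (𝓝 0) := by
      have h := (Real.continuousAt_rpow_const 0 (M - N) (Or.inr (by linarith))).tendsto
      rw [Real.zero_rpow (by linarith)] at h
      exact h.mono_left nhdsWithin_le_nhds
    refine IsLittleO.congr' (((isLittleO_one_iff ℝ).2 hlim).mul_isBigO
      (isBigO_refl (fun t : ℝ => t ^ N) _)) ?_ (Eventually.of_forall fun t => one_mul _)
    filter_upwards [self_mem_nhdsWithin] with t ht
    rw [← Real.rpow_add ht, sub_add_cancel]
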